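/- Let $p$ be a prime, $q=p^a\ne 3$, let $\omega$ generate $\mathbb F_q^*$, and let $r>1$ be a divisor of $q-1$. Let $V=\mathbb F_q^2$ (row vectors, maps act on the right) with standard basis $e_1,e_2$, and for $v\in V\setminus\{0\}$ write $\langle\omega^r\rangle v=\{cv\mid c\in\langle\omega^r\rangle\}$; for a set $S$ of nonzero vectors write $\langle\omega^r\rangle S=\{\langle\omega^r\rangle v\mid v\in S\}$. The group $\Gamma\mathrm L_2(q)$ of invertible semilinear maps of $V$ acts on $\Omega=\{\langle\omega^r\rangle v\mid 0\ne v\in V\}$. Put $Y=\langle\omega^rI\rangle$, $Z=\langle\omega I\rangle$, and $\phi:(x,y)\mapsto(x^p,y^p)$. Let $\alpha=\langle\omega^r\rangle e_1$, $\beta=\langle\omega^r\rangle e_2$ and $\sigma=\{\langle\omega^r\rangle\omega^ie_1\mid 0\le i<r\}$. Let $Y\,\mathrm{SL}_2(q)\le G\le\Gamma\mathrm L_2(q)$, and suppose that the permutation group $G^\Omega$ induced by $G$ on $\Omega$ is transitive and imprimitive of rank $3$ (a point stabiliser has exactly three orbits), and is either innately transitive (it has a transitive minimal normal subgroup) or semiprimitive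 (every normal subgroup is transitive or semiregular) with almost simple action on its unique nontrivial system of imprimitivity. Let $B$ be a nontrivial block of imprimitivity, containing $\beta$, for the action of $G_\alpha$ on $\Omega\setminus\sigma$ (that is, $B\subseteq\Omega\setminus\sigma$, the $G_\alpha$-translates of $B$ are equal or disjoint, $|B|>1$ and $B\neq\Omega\setminus\sigma$). Then one of the following holds: 1. $B=B_1=\langle\omega^r\rangle\{e_2,\omega e_2,\dots,\omega^{r-1}e_2\}$, of size $r$; 2. $B=B_2=\langle\omega^r\rangle\{\lambda e_1+e_2\mid\lambda\in\mathbb F_q\}$, of size $q$; 3. one of the following (with $|B|$ as indicated): - $q=4$, $r=3$, $G=\Gamma\mathrm L_2(4)$, and $B=\langle\omega^3\rangle\{e_2,\,e_1+e_2\}$ (size $2$) or $B=\langle\omega^3\rangle\{(1+\lambda)e_1+\lambda e_2\mid\lambda\in\mathbb F_4^*\}$ (size $3$), where $\langle\omega^3\rangle=1$; - $q=2^4$, $r=5$, $G=\Gamma\mathrm L_2(2^4)$, and $B=\langle\omega^5\rangle\{\lambda e_1+e_2\mid\lambda\in\mathbb F_4\}$ (size $4$); - $q=3^4$, $r=5$,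 $G=Z\,\mathrm{SL}_2(3^4)\rtimes\langle\phi\rangle$, and $B=\langle\omega^5\rangle\{\lambda e_1+e_2\mid\lambda\in c\,\mathbb F_9\}$ with $c\in\{1,\omega^5\}$ (size $9$); - $q=5^2$, $r=3$, $G=Z\,\mathrm{SL}_2(5^2)\rtimes\langle\phi\rangle$, and $B=\langle\omega^3\rangle\{\lambda e_1+e_2\mid\lambda\in c\,\mathbb F_5\}$ with $c\in\{1,\omega^3\}$ (size $5$); - $q=3^2$, $r=2$, $G$ is one of the two $\Gamma\mathrm L_2(9)$-conjugate groups $\langle Y\,\mathrm{SL}_2(9),\phi\,\mathrm{diag}(1,\omega)\rangle$ and $\langle Y\,\mathrm{SL}_2(9),\phi\,\mathrm{diag}(1,\omega^3)\rangle$, and $B=\langle\omega^2\rangle\{\lambda e_1+e_2\mid\lambda\in\omega^i\mathbb F_3\}$ with $0\le i\le3$ (size $3$). Conversely, for every such $G$, the sets $B_1$ and $B_2$, and each set $B$ listed in 3 for the given $q,r,G$, are nontrivial blocks containing $\beta$ for the action of $G_\alpha$ on $\Omega\setminus\sigma$. -/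

import Mathlib

/-! ### Permutation groups -/

section PermGroups

open MulAction

variable {X : Type*}

/-- `H` is transitive on the (nonempty) set `X` and every point stabiliser has exactly three
orbits on `X`. -/
def IsRankThree (H : Subgroup (Equiv.Perm X)) : Prop :=
  Nonempty X ∧ IsPretransitive H X ∧
    ∀ x : X, Nat.card (orbitRel.Quotient (stabilizer H x) X) = 3

/-- A subgroup is semiregular if only the identity fixes a point. -/
def IsSemiregular {H : Subgroup (Equiv.Perm X)} (N : Subgroup H) : Prop :=
  ∀ n ∈ N, ∀ x : X, n • x = x → n = 1

/-- Transitive, and every normal subgroup is transitive or semiregular. -/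
def IsSemiprimitive (H : Subgroup (Equiv.Perm X)) : Prop :=
  IsPretransitive H X ∧
    ∀ N : Subgroup H, N.Normal → IsPretransitive N X ∨ IsSemiregular N

/-- Minimal among the nontrivial normal subgroups. -/
def IsMinimalNormal {K : Type*} [Group K] (N : Subgroup K) : Prop :=
  N.Normal ∧ N ≠ ⊥ ∧ ∀ M : Subgroup K, M.Normal → M ≤ N → M = ⊥ ∨ M = N

/-- Transitive, with at least one transitive minimal normal subgroup. -/
def IsInnatelyTransitive (H : Subgroup (Equiv.Perm X)) : Prop :=
  IsPretransitive H X ∧ ∃ N : Subgroup H, IsMinimalNormal N ∧ IsPretransitive N X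

/-- `K` is almost simple: it has a nonabelian simple normal subgroup `T` with trivial centraliser
(so that conjugation gives `T ≤ K ≤ Aut T`). -/
def IsAlmostSimple (K : Type*) [Group K] : Prop :=
  ∃ T : Subgroup K, T.Normal ∧ IsSimpleGroup T ∧ (∃ x y : T, x * y ≠ y * x) ∧
    Subgroup.centralizer (T : Set K) = ⊥

/-- A nontrivial system of imprimitivity of `H`, given as an `H`-invariant equivalence relation
which is neither equality nor the universal relation. -/
def IsNontrivialSystem (H : Subgroup (Equiv.Perm X)) (S : Setoid X) : Prop :=
  (∀ h ∈ H, ∀ x y : X, S x y → S (h x) (h y)) ∧ S ≠ ⊥ ∧ S ≠ ⊤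

/-- The permutation group induced by `H` on the set of classes of `S`. -/
def inducedPermGroup (H : Subgroup (Equiv.Perm X)) (S : Setoid X) :
    Subgroup (Equiv.Perm (Quotient S)) where
  carrier := {π | ∃ h ∈ H, ∀ x : X, π (Quotient.mk S x) = Quotient.mk S (h x)}
  one_mem' := ⟨1, H.one_mem, fun _ => rfl⟩
  mul_mem' := by
    rintro π ρ ⟨g, hg, hπ⟩ ⟨h, hh, hρ⟩
    exact ⟨g * h, H.mul_mem hg hh, fun x => by simp [hπ, hρ]⟩
  inv_mem' := by
    rintro π ⟨g, hg, hπ⟩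
    refine ⟨g⁻¹, H.inv_mem hg, fun x => ?_⟩
    rw [Equiv.Perm.inv_eq_iff_eq, hπ]
    simp

/-- `H` is a transitive imprimitive permutation group of rank `3` which is either innately
transitive, or semiprimitive with almost simple action on its nontrivial system of imprimitivity.
(The nontrivial system of imprimitivity of an imprimitive group of rank `3` is unique.) -/
def IsRankThreeImprimitiveITorSP (H : Subgroup (Equiv.Perm X)) : Prop :=
  IsRankThree H ∧ ∃ S : Setoid X, IsNontrivialSystem H S ∧
    (IsInnatelyTransitive H ∨
      (IsSemiprimitive H ∧ IsAlmostSimple (inducedPermGroup H S)))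

/-- `B` is a nontrivial block of imprimitivity for the action of `K` on its invariant subset `D`:
the translates of `B` under `K` are equal or disjoint, and `1 < |B|`, `B ≠ D`. -/
def IsNontrivialBlockIn (K : Type*) [Group K] [MulAction K X] (D B : Set X) : Prop :=
  B ⊆ D ∧ IsBlock K B ∧ B.Nontrivial ∧ B ≠ D

end PermGroups

/-! ### The semilinear group of the plane -/

section Semilinear

variable (F : Type*) [Field F]

/-- The group of all invertible semilinear maps of `F²`. A subset of it is the same thing whether
vectors are written as rows (maps acting from the right) or as columns. -/
def GammaL : Subgroup (Equiv.Perm (Fin 2 → F)) where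
  carrier := {f | (∀ u v, f (u + v) = f u + f v) ∧
    ∃ τ : F ≃+* F, ∀ (c : F) (v : Fin 2 → F), f (c • v) = τ c • f v}
  one_mem' := ⟨fun _ _ => rfl, RingEquiv.refl F, fun _ _ => rfl⟩
  mul_mem' := by
    rintro f g ⟨hf, σ, hσ⟩ ⟨hg, τ, hτ⟩
    exact ⟨fun u v => by simp [hf, hg], τ.trans σ, fun c v => by simp [hσ, hτ]⟩
  inv_mem' := by
    rintro f ⟨hf, σ, hσ⟩
    refine ⟨fun u v => ?_, σ.symm, fun c v => ?_⟩
    · rw [Equiv.Perm.inv_eq_iff_eq, hf]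
      simp
    · rw [Equiv.Perm.inv_eq_iff_eq, hσ]
      simp

variable {F}

/-- An invertible linear map, as an element of the semilinear group. -/
def ofLinear : ((Fin 2 → F) ≃ₗ[F] (Fin 2 → F)) →* GammaL F where
  toFun l := ⟨l.toEquiv, l.map_add, RingEquiv.refl F, l.map_smul⟩
  map_one' := rfl
  map_mul' _ _ := rfl

variable (F) in
/-- `SL₂(q)`. -/
noncomputable def SL2 : Subgroup (GammaL F) :=
  (LinearEquiv.det (R := F) (M := Fin 2 → F)).ker.map ofLinear

/-- The scalar map with factor `c`. -/
def scalarMap (c : Fˣ) : GammaL F := ofLinear (LinearEquiv.smulOfUnit c)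

/-- The diagonal map `x e₁ + y e₂ ↦ c x e₁ + d y e₂`. -/
def diagMap (c d : Fˣ) : GammaL F :=
  ofLinear (LinearEquiv.piCongrRight fun i => LinearEquiv.smulOfUnit (![c, d] i))

/-- The semilinear map `φ : x e₁ + y e₂ ↦ xᵖ e₁ + yᵖ e₂`. -/
noncomputable def phiMap [Finite F] (p : ℕ) [Fact p.Prime] [CharP F p] : GammaL F :=
  ⟨Equiv.piCongrRight fun _ => (frobeniusEquiv F p).toEquiv,
    fun u v => by ext i; simp,
    frobeniusEquiv F p, fun c v => by ext i; simp⟩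

end Semilinear

/-! ### The action on the orbits of `⟨ωʳ⟩` on nonzero vectors -/

section Points

variable {F : Type*} [Field F]

/-- The set `⟨ωʳ⟩ v` of vectors. -/
def omr (ω : Fˣ) (r : ℕ) (v : Fin 2 → F) : Set (Fin 2 → F) :=
  {w | ∃ c ∈ Subgroup.zpowers (ω ^ r), w = (c : F) • v}

/-- The set `Ω` of all `⟨ωʳ⟩ v` with `v ≠ 0`. -/
def Points (ω : Fˣ) (r : ℕ) : Type _ :=
  {P : Set (Fin 2 → F) // ∃ v : Fin 2 → F, v ≠ 0 ∧ P = omr ω r v}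

/-- The point `⟨ωʳ⟩ v`. -/
def point (ω : Fˣ) (r : ℕ) (v : Fin 2 → F) (hv : v ≠ 0) : Points ω r :=
  ⟨omr ω r v, v, hv, rfl⟩

theorem mem_zpowers_of_ringEquiv [Finite F] (τ : F ≃+* F) (x c : Fˣ)
    (hc : c ∈ Subgroup.zpowers x) : Units.mapEquiv τ.toMulEquiv c ∈ Subgroup.zpowers x := by
  obtain ⟨m, hm⟩ := MonoidHom.map_cyclic (Units.mapEquiv τ.toMulEquiv).toMonoidHom
  have h : Units.mapEquiv τ.toMulEquiv c = c ^ m := hm c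
  rw [h]
  exact Subgroup.zpow_mem _ hc m

theorem image_omr [Finite F] (ω : Fˣ) (r : ℕ) (g : GammaL F) (v : Fin 2 → F) :
    g.1 '' omr ω r v = omr ω r (g.1 v) := by
  obtain ⟨f, hf, τ, hτ⟩ := g
  ext w
  constructor
  · rintro ⟨_, ⟨c, hc, rfl⟩, rfl⟩
    exact ⟨_, mem_zpowers_of_ringEquiv τ _ c hc, hτ _ _⟩
  · rintro ⟨c, hc, rfl⟩
    refine ⟨_, ⟨_, mem_zpowers_of_ringEquiv τ.symm _ c hc, rfl⟩, ?_⟩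
    simp [hτ]

theorem gammaL_apply_ne_zero (g : GammaL F) {v : Fin 2 → F} (hv : v ≠ 0) : g.1 v ≠ 0 := by
  have h0 : g.1 0 = 0 := by simpa using g.2.1 0 0
  intro h
  exact hv (g.1.injective (h.trans h0.symm))

/-- The action of the semilinear group on `Ω`: `g` maps `⟨ωʳ⟩ v` to `⟨ωʳ⟩ g(v)`. -/
instance Points.instMulAction [Finite F] (ω : Fˣ) (r : ℕ) :
    MulAction (GammaL F) (Points ω r) where
  smul g P := ⟨g.1 '' P.1, by
    obtain ⟨v, hv, hP⟩ := P.2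
    exact ⟨g.1 v, gammaL_apply_ne_zero g hv, by rw [hP, image_omr]⟩⟩
  one_smul P := Subtype.ext (Set.image_id P.1)
  mul_smul g h P := Subtype.ext (Set.image_comp g.1 h.1 P.1)

/-- The basis vector `e₁`. -/
def e1 : Fin 2 → F := ![1, 0]

/-- The basis vector `e₂`. -/
def e2 : Fin 2 → F := ![0, 1]

theorem e1_ne_zero : (e1 : Fin 2 → F) ≠ 0 := fun h => one_ne_zero (congrFun h 0)

/-- The point `α = ⟨ωʳ⟩ e₁`. -/
def alphaPt (ω : Fˣ) (r : ℕ) : Points ω r := point ω r e1 e1_ne_zero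

theorem e2_ne_zero : (e2 : Fin 2 → F) ≠ 0 := fun h => one_ne_zero (congrFun h 1)

/-- The point `β = ⟨ωʳ⟩ e₂`. -/
def betaPt (ω : Fˣ) (r : ℕ) : Points ω r := point ω r e2 e2_ne_zero

/-- The set `⟨ωʳ⟩ S = {⟨ωʳ⟩ v | v ∈ S}` of points, for a set `S` of nonzero vectors. -/
def pts (ω : Fˣ) (r : ℕ) (S : Set (Fin 2 → F)) : Set (Points ω r) :=
  {P | ∃ v ∈ S, P.1 = omr ω r v}

/-- `σ(⟨u⟩) = {⟨ωʳ⟩ ωⁱ u | 0 ≤ i < r}`. -/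
def sigmaOf (ω : Fˣ) (r : ℕ) (u : Fin 2 → F) : Set (Points ω r) :=
  pts ω r {v | ∃ i < r, v = ((ω ^ i : Fˣ) : F) • u}

/-- The permutation group `G^Ω` induced by `G` on `Ω`. -/
def permGroupOn [Finite F] (ω : Fˣ) (r : ℕ) (G : Subgroup (GammaL F)) :
    Subgroup (Equiv.Perm (Points ω r)) :=
  (MulAction.toPermHom G (Points ω r)).range

/-- `Y SL₂(q)`, where `Y = ⟨ωʳ I⟩`; for `r = 1` and a generator `ω` this is `Z SL₂(q)`. -/
noncomputable def YSL2 (ω : Fˣ) (r : ℕ) : Subgroup (GammaL F) :=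
  Subgroup.zpowers (scalarMap (ω ^ r)) ⊔ SL2 F

/-- `⟨ωʳ⟩ {x e₁ + e₂ | x ∈ L}`. -/
def lineBlock (ω : Fˣ) (r : ℕ) (L : Set F) : Set (Points ω r) :=
  pts ω r {v | ∃ x ∈ L, v = x • e1 + e2}

/-- The coset `c 𝔽_{q₀}` of the subfield with `q₀` elements (the set of roots of `X^q₀ - X`). -/
def mulSubfield (c : F) (q₀ : ℕ) : Set F := {x | ∃ y : F, y ^ q₀ = y ∧ x = c * y}

/-- The block `B₁ = ⟨ωʳ⟩ {e₂, ω e₂, …, ω^(r-1) e₂}`. -/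
def blockB1 (ω : Fˣ) (r : ℕ) : Set (Points ω r) := sigmaOf ω r e2

/-- The block `B₂ = ⟨ωʳ⟩ {x e₁ + e₂ | x ∈ F}`. -/
def blockB2 (ω : Fˣ) (r : ℕ) : Set (Points ω r) := lineBlock ω r Set.univ

/-- The table of additional blocks `B`, of size `k`, for the group `G`; one disjunct per line.
Products such as `φ diag(1, ω)` of maps acting from the right become `diag(1, ω) * φ`.
In the last line the group is given up to conjugation in the semilinear group, and there are
two conjugates. -/
def IsAdditionalBlock [Finite F] (p : ℕ) [Fact p.Prime] [CharP F p] (ω : Fˣ) (r : ℕ)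
    (G : Subgroup (GammaL F)) (B : Set (Points ω r)) (k : ℕ) : Prop :=
  (Nat.card F = 4 ∧ r = 3 ∧ G = ⊤ ∧
    ((B = pts ω r {e2, e1 + e2} ∧ k = 2) ∨
      (B = pts ω r {v | ∃ x : F, x ≠ 0 ∧ v = (1 + x) • e1 + x • e2} ∧ k = 3))) ∨
  (Nat.card F = 2 ^ 4 ∧ r = 5 ∧ G = ⊤ ∧
    B = lineBlock ω r (mulSubfield 1 4) ∧ k = 4) ∨
  (Nat.card F = 3 ^ 4 ∧ r = 5 ∧ G = YSL2 ω 1 ⊔ Subgroup.zpowers (phiMap p) ∧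
    (B = lineBlock ω r (mulSubfield 1 9) ∨
      B = lineBlock ω r (mulSubfield ((ω : F) ^ 5) 9)) ∧ k = 9) ∨
  (Nat.card F = 5 ^ 2 ∧ r = 3 ∧ G = YSL2 ω 1 ⊔ Subgroup.zpowers (phiMap p) ∧
    (B = lineBlock ω r (mulSubfield 1 5) ∨
      B = lineBlock ω r (mulSubfield ((ω : F) ^ 3) 5)) ∧ k = 5) ∨
  (Nat.card F = 3 ^ 2 ∧ r = 2 ∧
    (G = YSL2 ω 2 ⊔ Subgroup.zpowers (diagMap 1 ω * phiMap p) ∨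
      G = YSL2 ω 2 ⊔ Subgroup.zpowers (diagMap 1 (ω ^ 3) * phiMap p)) ∧
    (∃ i ≤ 3, B = lineBlock ω r (mulSubfield ((ω : F) ^ i) 3)) ∧ k = 3)

end Points

/-! The group `G` contains `SL2 F`, the kernel of `detAut`, so it is the full preimage of its image
`H` in the group of pairs (determinant `d`, automorphism `τ`). A point off the first axis has
coordinates `(x, u)`, with `u` counted modulo `⟨ωʳ⟩` (its level). On these coordinates the
stabiliser of `α` acts exactly as the maps `(x, u) ↦ (τ x / d + t, d (τ u))` with `(d, τ) ∈ H` and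
`t` arbitrary (`exists_affAct`, `isBlock_iff_isAffBlock`). The problem thus becomes one about `H`
alone. Rank three makes `H` transitive on levels, and its automorphisms transitive on the nontrivial
levels (`isRankThreeDetAut_of_isRankThree`). Hence `r` is prime and, for `q = p ^ a`, `r ≤ a + 1`;
if equality holds, every automorphism occurs in `H`. For `r ≥ 3` a commutator argument yields
elements of `H` with trivial automorphism and determinant at any level (`exists_inl`). Let `P` be a
block through `(0, 1)`, and let `A` be its fibre over level `1`. Translations make `A` an additive
subgroup, and a block that leaves the trivial level meets all levels (`exists_mem`). If `A = F`,
then `P` is `B₂` or everything. If `A = 0`, then all levels are met, and a determinant `d ≠ 1` in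
`⟨ωʳ⟩` forces `x = 0`, giving `B₁` (`eq_axis`). The scalars supply `d = ω^(2r)` unless `q - 1 ∣ 2r`,
which leaves `q = 5` (again `B₁`) and `q = 4`, where a graph across the levels also appears. If `A`
is proper and nonzero, its multiplier field has `p ^ b` elements, `q = p ^ (b n)` with `n ≥ 2`, and
it contains `ω^(2r)`, so `q - 1 ∣ 2r (p ^ b - 1)`. Together with `r ≤ b n + 1` this leaves five
cases, all with `n = 2` (`arith_subfield`), so `A` is a coset `c 𝔽_k`. The key constraint
`pow_eq_one`, that `τ c / (d c)` lies in `𝔽_k` whenever `P` meets the level of `d`, then confines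
`P` to one level and determines `H` and `c`. Conversely, a line block needs only a fibre stable
under the pairs in `H` of trivial level, and the remaining two kinds are blocks for every `H`. -/

/-! ### Determinant and field automorphism of a semilinear map -/

section DetAut

variable {F : Type*} [Field F]

/-- The field automorphism accompanying a semilinear map. -/
noncomputable def semAut (g : GammaL F) : RingAut F := g.2.2.choose

theorem gammaL_map_smul (g : GammaL F) (c : F) (v : Fin 2 → F) :
    g.1 (c • v) = semAut g c • g.1 v := g.2.2.choose_spec c v

theorem gammaL_map_add (g : GammaL F) (u v : Fin 2 → F) : g.1 (u + v) = g.1 u + g.1 v :=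
  g.2.1 u v

theorem semAut_eq (g : GammaL F) (τ : RingAut F)
    (h : ∀ (c : F) (v : Fin 2 → F), g.1 (c • v) = τ c • g.1 v) : semAut g = τ := by
  refine RingEquiv.ext fun c => ?_
  have h1 := (gammaL_map_smul g c e1).symm.trans (h c e1)
  exact smul_left_injective F (gammaL_apply_ne_zero g e1_ne_zero) h1

theorem vec_eq (v : Fin 2 → F) : v = v 0 • e1 + v 1 • e2 := by
  ext i; fin_cases i <;> simp [e1, e2]

theorem gammaL_apply_eq (g : GammaL F) (v : Fin 2 → F) :
    g.1 v = semAut g (v 0) • g.1 e1 + semAut g (v 1) • g.1 e2 := by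
  conv_lhs => rw [vec_eq v]
  rw [gammaL_map_add, gammaL_map_smul, gammaL_map_smul]

theorem semAut_mul (g h : GammaL F) : semAut (g * h) = semAut g * semAut h := by
  refine semAut_eq _ _ fun c v => ?_
  change g.1 (h.1 (c • v)) = semAut g (semAut h c) • g.1 (h.1 v)
  rw [gammaL_map_smul, gammaL_map_smul]

theorem semAut_one : semAut (1 : GammaL F) = 1 := semAut_eq _ _ fun _ _ => rfl

/-- The determinant of the matrix with columns `g e₁`, `g e₂`. -/
def semDet (g : GammaL F) : F := g.1 e1 0 * g.1 e2 1 - g.1 e1 1 * g.1 e2 0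

/-- The twist by `semAut g` is the reason why `detAut` takes values in a semidirect product. -/
theorem semDet_mul (g h : GammaL F) : semDet (g * h) = semDet g * semAut g (semDet h) := by
  have h1 : (g * h).1 e1 = g.1 (h.1 e1) := rfl
  have h2 : (g * h).1 e2 = g.1 (h.1 e2) := rfl
  rw [semDet, h1, h2, gammaL_apply_eq g (h.1 e1), gammaL_apply_eq g (h.1 e2)]
  simp only [semDet, Pi.add_apply, Pi.smul_apply, smul_eq_mul, map_sub, map_mul]
  ring

theorem semDet_one : semDet (1 : GammaL F) = 1 := by
  change (e1 : Fin 2 → F) 0 * e2 1 - e1 1 * e2 0 = 1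
  simp [e1, e2]

theorem semDet_ne_zero (g : GammaL F) : semDet g ≠ 0 := by
  intro h
  have := semDet_mul g g⁻¹
  rw [mul_inv_cancel, semDet_one, h, zero_mul] at this
  exact one_ne_zero this

variable (F) in
/-- Field automorphisms act on the multiplicative group. -/
def unitsAutHom : RingAut F →* MulAut Fˣ where
  toFun τ := Units.mapEquiv τ.toMulEquiv
  map_one' := by ext; rfl
  map_mul' _ _ := by ext; rfl

@[simp] theorem coe_unitsAutHom (τ : RingAut F) (u : Fˣ) :
    ((unitsAutHom F τ u : Fˣ) : F) = τ u := rfl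

variable (F) in
/-- The group of pairs (determinant, field automorphism). -/
abbrev DetAut : Type _ := Fˣ ⋊[unitsAutHom F] (RingAut F)

/-- Determinant and field automorphism of a semilinear map. -/
noncomputable def detAut : GammaL F →* DetAut F where
  toFun g := ⟨Units.mk0 (semDet g) (semDet_ne_zero g), semAut g⟩
  map_one' := by
    ext x
    · exact semDet_one
    · exact congrArg (fun t : RingAut F => t x) semAut_one
  map_mul' g h := by
    ext x
    · exact semDet_mul g h
    · exact congrArg (fun t : RingAut F => t x) (semAut_mul g h)

theorem detAut_left (g : GammaL F) : ((detAut g).left : F) = semDet g := rfl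

theorem detAut_right (g : GammaL F) : (detAut g).right = semAut g := rfl

theorem detAut_eq (g : GammaL F) (s : DetAut F) (h1 : semDet g = s.left)
    (h2 : ∀ (c : F) (v : Fin 2 → F), g.1 (c • v) = s.right c • g.1 v) : detAut g = s := by
  ext x
  · exact h1
  · exact congrArg (fun t : RingAut F => t x) (semAut_eq g _ h2)

theorem detAut_ofLinear (l : (Fin 2 → F) ≃ₗ[F] (Fin 2 → F)) :
    detAut (ofLinear l) = SemidirectProduct.inl (LinearEquiv.det l) := by
  refine detAut_eq _ _ ?_ fun c v => l.map_smul c v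
  have h : (l : (Fin 2 → F) →ₗ[F] (Fin 2 → F)).det = semDet (ofLinear l) := by
    rw [← LinearMap.det_toMatrix', Matrix.det_fin_two]
    simp only [LinearMap.toMatrix'_apply]
    have e3 : (Pi.single 0 (1 : F) : Fin 2 → F) = e1 := by
      ext i; fin_cases i <;> simp [e1]
    have e4 : (Pi.single 1 (1 : F) : Fin 2 → F) = e2 := by
      ext i; fin_cases i <;> simp [e2]
    simp only [e3, e4]
    change _ = l e1 0 * l e2 1 - l e1 1 * l e2 0
    simp only [LinearEquiv.coe_coe]
    ring
  rw [← h]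
  simp

/-- A semilinear map with trivial automorphism is linear. Consequently a group containing `SL2 F`
can be recovered from its image under `detAut`. -/
theorem ker_detAut : (detAut (F := F)).ker = SL2 F := by
  ext g
  constructor
  · intro hg
    have hg : detAut g = 1 := hg
    have h2 : semAut g = 1 := by rw [← detAut_right, hg]; rfl
    have hs : ∀ (c : F) (v : Fin 2 → F), g.1 (c • v) = c • g.1 v := fun c v => by
      rw [gammaL_map_smul, h2]; rfl
    let l : (Fin 2 → F) ≃ₗ[F] (Fin 2 → F) :=
      { g.1 with
        map_add' := gammaL_map_add g
        map_smul' := hs }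
    have hl : ofLinear l = g := Subtype.ext (Equiv.ext fun _ => rfl)
    refine ⟨l, ?_, hl⟩
    have h3 := detAut_ofLinear l
    rw [hl, hg] at h3
    exact (SemidirectProduct.inl_injective (h3.symm.trans (map_one _).symm))
  · rintro ⟨l, hl, rfl⟩
    have hl : LinearEquiv.det l = 1 := hl
    change detAut (ofLinear l) = 1
    rw [detAut_ofLinear, hl, map_one]

/-- The semilinear map `x e₁ + y e₂ ↦ (τ x + t d (τ y)) e₁ + d (τ y) e₂`, where `s = (d, τ)`. -/
def affMap (s : DetAut F) (t : F) : GammaL F :=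
  ⟨{ toFun := fun v => ![s.right (v 0) + t * (s.left * s.right (v 1)), s.left * s.right (v 1)]
     invFun := fun v =>
      ![s.right.symm (v 0 - t * v 1), s.right.symm (((s.left⁻¹ : Fˣ) : F) * v 1)]
     left_inv := fun v => by ext i; fin_cases i <;> simp
     right_inv := fun v => by ext i; fin_cases i <;> simp },
   fun u v => by ext i; fin_cases i <;> simp <;> ring,
   s.right, fun c v => by ext i; fin_cases i <;> simp <;> ring⟩

theorem affMap_apply (s : DetAut F) (t : F) (v : Fin 2 → F) :
    (affMap s t).1 v =
      ![s.right (v 0) + t * (s.left * s.right (v 1)), s.left * s.right (v 1)] := rfl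

theorem detAut_affMap (s : DetAut F) (t : F) : detAut (affMap s t) = s := by
  refine detAut_eq _ _ ?_ fun c v => ?_
  · simp [semDet, affMap_apply, e1, e2]
  · simp only [affMap_apply]
    ext i; fin_cases i <;> simp <;> ring

theorem detAut_surjective : Function.Surjective (detAut (F := F)) :=
  fun s => ⟨_, detAut_affMap s 0⟩

theorem detAut_scalarMap (c : Fˣ) : detAut (scalarMap c) = SemidirectProduct.inl (c ^ 2) := by
  refine detAut_eq _ _ ?_ fun a v => ?_
  · change (c : F) * (1 : F) * ((c : F) * 1) - (c : F) * 0 * ((c : F) * 0) = _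
    rw [SemidirectProduct.left_inl]; push_cast; ring
  · exact (LinearEquiv.smulOfUnit (M := Fin 2 → F) c).map_smul a v

theorem detAut_diagMap (c d : Fˣ) : detAut (diagMap c d) = SemidirectProduct.inl (c * d) := by
  refine detAut_eq _ _ ?_ fun a v => ?_
  · change (c : F) * (1 : F) * ((d : F) * 1) - (d : F) * 0 * ((c : F) * 0) = _
    simp
  · exact (LinearEquiv.piCongrRight fun i => LinearEquiv.smulOfUnit (![c, d] i) :
      (Fin 2 → F) ≃ₗ[F] (Fin 2 → F)).map_smul a v

/-- The Frobenius automorphism. -/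
noncomputable def frobAut (F : Type*) [Field F] [Finite F] (p : ℕ) [Fact p.Prime] [CharP F p] :
    RingAut F := frobeniusEquiv F p

theorem frobAut_apply [Finite F] (p : ℕ) [Fact p.Prime] [CharP F p] (x : F) :
    frobAut F p x = x ^ p := rfl

theorem detAut_phiMap [Finite F] (p : ℕ) [Fact p.Prime] [CharP F p] :
    detAut (phiMap (F := F) p) = SemidirectProduct.inr (frobAut F p) := by
  refine detAut_eq _ _ ?_ fun c v => ?_
  · change (1 : F) ^ p * (1 : F) ^ p - (0 : F) ^ p * (0 : F) ^ p = _
    simp [(Fact.out : p.Prime).ne_zero]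
  · ext i
    change (c * v i) ^ p = c ^ p * (v i) ^ p
    rw [mul_pow]

theorem map_detAut_YSL2 (ω : Fˣ) (r : ℕ) :
    (YSL2 ω r).map detAut = Subgroup.zpowers (SemidirectProduct.inl ((ω ^ r) ^ 2)) := by
  have h : (SL2 F).map detAut = ⊥ := by
    rw [← ker_detAut, Subgroup.map_eq_bot_iff]
  rw [YSL2, Subgroup.map_sup, h, sup_bot_eq, MonoidHom.map_zpowers, detAut_scalarMap]

theorem ker_detAut_le_of_YSL2_le {ω : Fˣ} {r : ℕ} {G : Subgroup (GammaL F)} (hG : YSL2 ω r ≤ G) :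
    (detAut (F := F)).ker ≤ G := by
  rw [ker_detAut]; exact le_sup_right.trans hG

theorem mem_iff_detAut_mem {ω : Fˣ} {r : ℕ} {G : Subgroup (GammaL F)} (hG : YSL2 ω r ≤ G)
    (g : GammaL F) : g ∈ G ↔ detAut g ∈ G.map detAut := by
  rw [← Subgroup.mem_comap, Subgroup.comap_map_eq_self (ker_detAut_le_of_YSL2_le hG)]

theorem eq_iff_map_detAut_eq {G K : Subgroup (GammaL F)} (hG : (detAut (F := F)).ker ≤ G)
    (hK : (detAut (F := F)).ker ≤ K) : G = K ↔ G.map detAut = K.map detAut :=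
  ⟨fun h => h ▸ rfl, fun h => by
    rw [← Subgroup.comap_map_eq_self hG, ← Subgroup.comap_map_eq_self hK, h]⟩

theorem inl_sq_mem_of_YSL2_le {ω : Fˣ} {r : ℕ} {G : Subgroup (GammaL F)} (hG : YSL2 ω r ≤ G) :
    SemidirectProduct.inl ((ω ^ r) ^ 2) ∈ G.map detAut :=
  Subgroup.map_mono hG (by rw [map_detAut_YSL2]; exact Subgroup.mem_zpowers _)

end DetAut

/-! ### Coordinates on the points off the first axis -/

section AffinePoints

variable {F : Type*} [Field F]

theorem omr_eq_iff (ω : Fˣ) (r : ℕ) (v w : Fin 2 → F) :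
    omr ω r v = omr ω r w ↔ ∃ c ∈ Subgroup.zpowers (ω ^ r), w = (c : F) • v := by
  constructor
  · intro h
    have : w ∈ omr ω r w := ⟨1, one_mem _, by simp⟩
    rw [← h] at this
    exact this
  · rintro ⟨c, hc, rfl⟩
    ext z
    constructor
    · rintro ⟨d, hd, rfl⟩
      exact ⟨d * c⁻¹, mul_mem hd (inv_mem hc), by simp [smul_smul]⟩
    · rintro ⟨d, hd, rfl⟩
      exact ⟨d * c, mul_mem hd hc, by simp [smul_smul]⟩

theorem point_eq_iff (ω : Fˣ) (r : ℕ) {v w : Fin 2 → F} (hv : v ≠ 0) (hw : w ≠ 0) :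
    point ω r v hv = point ω r w hw ↔ ∃ c ∈ Subgroup.zpowers (ω ^ r), w = (c : F) • v :=
  Subtype.ext_iff.trans (omr_eq_iff ω r v w)

theorem smul_point [Finite F] (ω : Fˣ) (r : ℕ) (g : GammaL F) {v : Fin 2 → F} (hv : v ≠ 0) :
    g • point ω r v hv = point ω r (g.1 v) (gammaL_apply_ne_zero g hv) :=
  Subtype.ext (image_omr ω r g v)

theorem mem_sigmaOf_iff {ω : Fˣ} (hω : ∀ x : Fˣ, x ∈ Subgroup.zpowers ω) {r : ℕ} (hr : 0 < r)
    (u : Fin 2 → F) (P : Points ω r) :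
    P ∈ sigmaOf ω r u ↔ ∃ c : Fˣ, P.1 = omr ω r ((c : F) • u) := by
  constructor
  · rintro ⟨v, ⟨i, -, rfl⟩, h⟩
    exact ⟨ω ^ i, h⟩
  · rintro ⟨c, hc⟩
    obtain ⟨m, rfl⟩ := Subgroup.mem_zpowers_iff.1 (hω c)
    have hr' : (0 : ℤ) < r := by exact_mod_cast hr
    obtain ⟨i, hi⟩ := Int.eq_ofNat_of_zero_le (Int.emod_nonneg m hr'.ne')
    refine ⟨_, ⟨i, ?_, rfl⟩, ?_⟩
    · have := Int.emod_lt_of_pos m hr'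
      omega
    · rw [hc, omr_eq_iff]
      refine ⟨(ω ^ r) ^ (-(m / r)), Subgroup.zpow_mem _ (Subgroup.mem_zpowers _) _, ?_⟩
      rw [smul_smul, ← Units.val_mul]
      congr 2
      rw [← zpow_natCast ω r, ← zpow_mul, ← zpow_add, ← zpow_natCast ω i]
      congr 1
      have := Int.mul_ediv_add_emod m r
      rw [hi] at this
      linarith [mul_neg (r : ℤ) (m / r)]

theorem aff_ne_zero (x : F) (u : Fˣ) : (![u * x, (u : F)] : Fin 2 → F) ≠ 0 :=
  fun h => u.ne_zero (congrFun h 1)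

/-- The point `⟨ωʳ⟩ u (x e₁ + e₂)`. -/
def affPt (ω : Fˣ) (r : ℕ) (x : F) (u : Fˣ) : Points ω r :=
  point ω r ![u * x, u] (aff_ne_zero x u)

theorem affPt_eq_iff (ω : Fˣ) (r : ℕ) (x y : F) (u w : Fˣ) :
    affPt ω r x u = affPt ω r y w ↔ x = y ∧ w / u ∈ Subgroup.zpowers (ω ^ r) := by
  rw [affPt, affPt, point_eq_iff]
  constructor
  · rintro ⟨c, hc, h⟩
    have h0 := congrFun h 0
    have h1 := congrFun h 1
    simp only [Matrix.cons_val_zero, Matrix.cons_val_one, Pi.smul_apply, smul_eq_mul] at h0 h1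
    have h2 : w = c * u := Units.ext h1
    subst h2
    refine ⟨?_, by simpa using hc⟩
    rw [Units.val_mul, mul_assoc] at h0
    exact (mul_left_cancel₀ u.ne_zero (mul_left_cancel₀ c.ne_zero h0)).symm
  · rintro ⟨rfl, h⟩
    refine ⟨w / u, h, ?_⟩
    ext i; fin_cases i <;> simp [← mul_assoc]

theorem betaPt_eq (ω : Fˣ) (r : ℕ) : betaPt ω r = affPt ω r 0 1 := by
  refine (point_eq_iff ω r _ _).2 ⟨1, one_mem _, ?_⟩
  ext i; fin_cases i <;> simp [e2]

theorem alphaPt_mem_sigmaOf {ω : Fˣ} (hω : ∀ x : Fˣ, x ∈ Subgroup.zpowers ω) {r : ℕ}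
    (hr : 0 < r) : alphaPt ω r ∈ sigmaOf ω r e1 :=
  (mem_sigmaOf_iff hω hr _ _).2 ⟨1, by rw [Units.val_one, one_smul]; rfl⟩

theorem affPt_notMem_sigmaOf {ω : Fˣ} (hω : ∀ x : Fˣ, x ∈ Subgroup.zpowers ω) {r : ℕ}
    (hr : 0 < r) (x : F) (u : Fˣ) : affPt ω r x u ∉ sigmaOf ω r e1 := by
  rw [mem_sigmaOf_iff hω hr]
  rintro ⟨c, hc⟩
  obtain ⟨d, -, h⟩ := (omr_eq_iff _ _ _ _).1 hc
  have h1 := congrFun h 1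
  simp [e1] at h1

theorem exists_affPt {ω : Fˣ} (hω : ∀ x : Fˣ, x ∈ Subgroup.zpowers ω) {r : ℕ} (hr : 0 < r)
    (P : Points ω r) (hP : P ∉ sigmaOf ω r e1) : ∃ x u, P = affPt ω r x u := by
  obtain ⟨P, v, hv, rfl⟩ := P
  by_cases h1 : v 1 = 0
  · have h0 : v 0 ≠ 0 := by
      intro h0
      apply hv
      ext i; fin_cases i
      exacts [h0, h1]
    refine absurd ((mem_sigmaOf_iff hω hr _ _).2 ⟨Units.mk0 _ h0, ?_⟩) hP
    change omr ω r v = _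
    refine congrArg (omr ω r) ?_
    ext i; fin_cases i <;> simp [e1, h1]
  · refine ⟨v 0 / v 1, Units.mk0 _ h1, Subtype.ext ?_⟩
    change omr ω r v = omr ω r _
    congr 1
    ext i; fin_cases i <;> simp
    field_simp

/-- The coordinates of the points of `B` off the first axis. -/
def affSet {ω : Fˣ} {r : ℕ} (B : Set (Points ω r)) : Set (F × Fˣ) :=
  {z | affPt ω r z.1 z.2 ∈ B}

theorem subset_iff_affSet_subset {ω : Fˣ} (hω : ∀ x : Fˣ, x ∈ Subgroup.zpowers ω) {r : ℕ}
    (hr : 0 < r) {B C : Set (Points ω r)} (hB : B ⊆ (sigmaOf ω r e1)ᶜ) :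
    B ⊆ C ↔ affSet B ⊆ affSet C := by
  refine ⟨fun h z hz => h hz, fun h P hP => ?_⟩
  obtain ⟨x, u, rfl⟩ := exists_affPt hω hr P (hB hP)
  exact h (a := (x, u)) hP

theorem eq_iff_affSet_eq {ω : Fˣ} (hω : ∀ x : Fˣ, x ∈ Subgroup.zpowers ω) {r : ℕ}
    (hr : 0 < r) {B C : Set (Points ω r)} (hB : B ⊆ (sigmaOf ω r e1)ᶜ)
    (hC : C ⊆ (sigmaOf ω r e1)ᶜ) : B = C ↔ affSet B = affSet C := by
  refine ⟨fun h => h ▸ rfl, fun h => ?_⟩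
  exact ((subset_iff_affSet_subset hω hr hB).2 h.subset).antisymm
    ((subset_iff_affSet_subset hω hr hC).2 h.symm.subset)

theorem affSet_mul_mem {ω : Fˣ} {r : ℕ} (B : Set (Points ω r)) (x : F) (u l : Fˣ)
    (hl : l ∈ Subgroup.zpowers (ω ^ r)) (h : (x, u) ∈ affSet B) : (x, l * u) ∈ affSet B := by
  have : affPt ω r x (l * u) = affPt ω r x u :=
    ((affPt_eq_iff ω r x x u (l * u)).2 ⟨rfl, by simpa using hl⟩).symm
  change affPt ω r x (l * u) ∈ B
  rw [this]; exact h

theorem affSet_sigmaOf_compl {ω : Fˣ} (hω : ∀ x : Fˣ, x ∈ Subgroup.zpowers ω) {r : ℕ}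
    (hr : 0 < r) : affSet (sigmaOf ω r e1)ᶜ = Set.univ :=
  Set.eq_univ_of_forall fun z => affPt_notMem_sigmaOf hω hr z.1 z.2

theorem lineBlock_subset {ω : Fˣ} (hω : ∀ x : Fˣ, x ∈ Subgroup.zpowers ω) {r : ℕ}
    (hr : 0 < r) (A : Set F) : lineBlock ω r A ⊆ (sigmaOf ω r e1)ᶜ := by
  rintro P ⟨v, ⟨x, hx, rfl⟩, h⟩
  have : P = affPt ω r x 1 := by
    refine Subtype.ext (h.trans ?_)
    change _ = omr ω r _
    congr 1
    ext i; fin_cases i <;> simp [e1, e2]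
  rw [this]
  exact affPt_notMem_sigmaOf hω hr x 1

theorem lineBlock_eq_image (ω : Fˣ) (r : ℕ) (A : Set F) :
    lineBlock ω r A = (fun x => affPt ω r x 1) '' A := by
  have key : ∀ x : F, (affPt ω r x 1).1 = omr ω r (x • e1 + e2) := fun x => by
    change omr ω r _ = _
    congr 1
    ext i; fin_cases i <;> simp [e1, e2]
  ext P
  constructor
  · rintro ⟨v, ⟨x, hx, rfl⟩, h⟩
    exact ⟨x, hx, Subtype.ext ((key x).trans h.symm)⟩
  · rintro ⟨x, hx, rfl⟩
    exact ⟨_, ⟨x, hx, rfl⟩, key x⟩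

theorem ncard_lineBlock (ω : Fˣ) (r : ℕ) (A : Set F) : (lineBlock ω r A).ncard = A.ncard := by
  rw [lineBlock_eq_image]
  exact Set.ncard_image_of_injective _ fun x y h => ((affPt_eq_iff ω r x y 1 1).1 h).1

theorem affSet_lineBlock (ω : Fˣ) (r : ℕ) (A : Set F) :
    affSet (lineBlock ω r A) = {z | z.1 ∈ A ∧ z.2 ∈ Subgroup.zpowers (ω ^ r)} := by
  ext ⟨x, u⟩
  rw [lineBlock_eq_image]
  constructor
  · rintro ⟨y, hy, h⟩
    obtain ⟨rfl, h2⟩ := (affPt_eq_iff ω r y x 1 u).1 h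
    exact ⟨hy, by simpa using h2⟩
  · rintro ⟨hx, hu⟩
    exact ⟨x, hx, (affPt_eq_iff ω r x x 1 u).2 ⟨rfl, by simpa using hu⟩⟩

theorem point_smul_e2 (ω : Fˣ) (r : ℕ) (u : Fˣ) :
    (affPt ω r 0 u).1 = omr ω r ((u : F) • e2) := by
  change omr ω r _ = _
  congr 1
  ext i; fin_cases i <;> simp [e2]

theorem blockB1_subset {ω : Fˣ} (hω : ∀ x : Fˣ, x ∈ Subgroup.zpowers ω) {r : ℕ}
    (hr : 0 < r) : blockB1 ω r ⊆ (sigmaOf ω r e1)ᶜ := by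
  intro P hP
  obtain ⟨c, hc⟩ := (mem_sigmaOf_iff hω hr _ _).1 hP
  have : P = affPt ω r 0 c := Subtype.ext (hc.trans (point_smul_e2 ω r c).symm)
  rw [this]
  exact affPt_notMem_sigmaOf hω hr 0 c

theorem affSet_blockB1 {ω : Fˣ} (hω : ∀ x : Fˣ, x ∈ Subgroup.zpowers ω) {r : ℕ}
    (hr : 0 < r) : affSet (blockB1 ω r) = {z | z.1 = 0} := by
  ext ⟨x, u⟩
  change affPt ω r x u ∈ sigmaOf ω r e2 ↔ x = 0
  rw [mem_sigmaOf_iff hω hr]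
  constructor
  · rintro ⟨c, hc⟩
    exact ((affPt_eq_iff ω r x 0 u c).1
      (Subtype.ext (hc.trans (point_smul_e2 ω r c).symm))).1
  · rintro rfl
    exact ⟨u, point_smul_e2 ω r u⟩

end AffinePoints

/-! ### The stabiliser of the first basis point -/

section StabilizerAction

variable {F : Type*} [Field F]

/-- The action of `x ↦ (τ x) / d + t`, `u ↦ d (τ u)` for `s = (d, τ)`. -/
def affAct (s : DetAut F) (t : F) (z : F × Fˣ) : F × Fˣ :=
  (s.right z.1 / s.left + t, s.left * unitsAutHom F s.right z.2)

/-- The translates of `P` under the maps `affAct s t` with `s ∈ H` that meet `P` lie in `P`. -/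
def IsAffBlock (H : Subgroup (DetAut F)) (P : Set (F × Fˣ)) : Prop :=
  ∀ s ∈ H, ∀ t, (∃ z ∈ P, affAct s t z ∈ P) → ∀ z ∈ P, affAct s t z ∈ P

variable [Finite F]

theorem affMap_smul_affPt (ω : Fˣ) (r : ℕ) (s : DetAut F) (t x : F) (u : Fˣ) :
    affMap s t • affPt ω r x u =
      affPt ω r (affAct s t (x, u)).1 (affAct s t (x, u)).2 := by
  rw [affPt, smul_point]
  refine Subtype.ext (congrArg (omr ω r) ?_)
  ext i; fin_cases i
  · simp [affMap_apply, affAct]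
    field_simp
  · simp [affMap_apply, affAct]

theorem affMap_smul_alphaPt (ω : Fˣ) (r : ℕ) (s : DetAut F) (t : F) :
    affMap s t • alphaPt ω r = alphaPt ω r := by
  rw [alphaPt, smul_point]
  refine Subtype.ext (congrArg (omr ω r) ?_)
  ext i; fin_cases i <;> simp [affMap_apply, e1]

theorem apply_e1_of_smul_alphaPt {ω : Fˣ} {r : ℕ} {g : GammaL F}
    (h : g • alphaPt ω r = alphaPt ω r) :
    ∃ c ∈ Subgroup.zpowers (ω ^ r), g.1 e1 = (c : F) • e1 := by
  rw [alphaPt, smul_point] at h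
  exact (point_eq_iff _ _ _ _).1 h.symm

/-- If `g e₁ = c e₁` with `c ∈ ⟨ωʳ⟩`, then dividing `g` by the scalar `c` stays in `G`, does not
change the action on points, and gives a map fixing the vector `e₁`. This divides the determinant by
`c²`, which is the correction made in `s`. -/
theorem exists_affAct {ω : Fˣ} {r : ℕ} {G : Subgroup (GammaL F)} (hG : YSL2 ω r ≤ G)
    {g : GammaL F} (hg : g ∈ G) (h : g • alphaPt ω r = alphaPt ω r) :
    ∃ s ∈ G.map detAut, ∃ t, ∀ x u,
      g • affPt ω r x u = affPt ω r (affAct s t (x, u)).1 (affAct s t (x, u)).2 := by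
  obtain ⟨c, hc, hce⟩ := apply_e1_of_smul_alphaPt h
  have hdet : semDet g = c * g.1 e2 1 := by
    rw [semDet, hce]; simp [e1]
  have hne : g.1 e2 1 ≠ 0 := by
    intro h0
    exact semDet_ne_zero g (by rw [hdet, h0, mul_zero])
  have hcmem : SemidirectProduct.inl (c ^ 2)⁻¹ ∈ G.map detAut := by
    obtain ⟨m, rfl⟩ := hc
    rw [map_inv]
    refine inv_mem ?_
    have := Subgroup.zpow_mem _ (inl_sq_mem_of_YSL2_le hG) m
    rw [← map_zpow] at this
    convert this using 2
    change ((ω ^ r) ^ m) ^ 2 = _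
    rw [← zpow_natCast, ← zpow_natCast (ω ^ r) 2, ← zpow_mul, ← zpow_mul, mul_comm]
  obtain ⟨s, hs, hl, hr'⟩ : ∃ s ∈ G.map detAut, ((s.left : Fˣ) : F) = g.1 e2 1 / c ∧
      s.right = semAut g := by
    refine ⟨SemidirectProduct.inl (c ^ 2)⁻¹ * detAut g,
      mul_mem hcmem (Subgroup.mem_map_of_mem _ hg), ?_, ?_⟩
    · rw [SemidirectProduct.mul_left, SemidirectProduct.left_inl, SemidirectProduct.right_inl,
        map_one, MulAut.one_apply, Units.val_mul, detAut_left, hdet]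
      push_cast
      field_simp
    · rw [SemidirectProduct.mul_right, SemidirectProduct.right_inl, one_mul, detAut_right]
  refine ⟨s, hs, g.1 e2 0 / g.1 e2 1, fun x u => ?_⟩
  rw [affPt, smul_point]
  refine (point_eq_iff _ _ _ _).2 ⟨c⁻¹, inv_mem hc, ?_⟩
  rw [gammaL_apply_eq g ![_, _], hce]
  ext i
  fin_cases i
  · simp only [affAct, hr', e1, Units.val_mul, coe_unitsAutHom, hl]
    simp
    field_simp
    simp [Matrix.vecHead]
    ring
  · simp only [affAct, hr', e1, Units.val_mul, coe_unitsAutHom, hl]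
    simp
    field_simp
    simp [Matrix.vecHead, Matrix.vecTail]
    ring

-- The maps `affMap s t` with `s` in the image of `G` lie in the stabiliser of `α`, and
-- `exists_affAct` shows that they induce everything the stabiliser induces off the axis.
-- `IsAffBlock` only asks for an inclusion; equality of translates follows by applying it to `g⁻¹`
-- too.
open scoped Pointwise in
theorem isBlock_iff_isAffBlock {ω : Fˣ} (hω : ∀ x : Fˣ, x ∈ Subgroup.zpowers ω) {r : ℕ}
    (hr : 0 < r) {G : Subgroup (GammaL F)} (hG : YSL2 ω r ≤ G) {B : Set (Points ω r)}
    (hB : B ⊆ (sigmaOf ω r e1)ᶜ) :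
    MulAction.IsBlock (MulAction.stabilizer G (alphaPt ω r)) B ↔
      IsAffBlock (G.map detAut) (affSet B) := by
  rw [MulAction.isBlock_iff_smul_eq_of_nonempty]
  constructor
  · rintro h s hs t ⟨z, hz, hz'⟩ w hw
    let g : MulAction.stabilizer G (alphaPt ω r) :=
      ⟨⟨affMap s t, (mem_iff_detAut_mem hG _).2 (by rwa [detAut_affMap])⟩,
        affMap_smul_alphaPt ω r s t⟩
    have hg : ∀ z : F × Fˣ, g • affPt ω r z.1 z.2 =
        affPt ω r (affAct s t z).1 (affAct s t z).2 := fun z => affMap_smul_affPt ω r s t z.1 z.2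
    have h1 : g • B = B := h ⟨_, ⟨_, hz, hg z⟩, hz'⟩
    change affPt ω r _ _ ∈ B
    rw [← hg w, ← h1]
    exact Set.smul_mem_smul_set hw
  · intro h g hg
    have key : ∀ g : MulAction.stabilizer G (alphaPt ω r), (g • B ∩ B).Nonempty → g • B ⊆ B := by
      rintro g ⟨_, ⟨P, hP, rfl⟩, hP'⟩
      obtain ⟨s, hs, t, hst⟩ := exists_affAct hG g.1.2 g.2
      have hst : ∀ x u, g • affPt ω r x u =
        affPt ω r (affAct s t (x, u)).1 (affAct s t (x, u)).2 := hst
      obtain ⟨x, u, rfl⟩ := exists_affPt hω hr P (hB hP)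
      have h1 := h s hs t ⟨(x, u), hP, by
        change affPt ω r _ _ ∈ B
        rw [← hst]; exact hP'⟩
      rintro _ ⟨Q, hQ, rfl⟩
      obtain ⟨y, w, rfl⟩ := exists_affPt hω hr Q (hB hQ)
      have h2 := h1 (y, w) hQ
      change affPt ω r _ _ ∈ B at h2
      rw [← hst] at h2
      exact h2
    refine (key g hg).antisymm ?_
    rw [Set.subset_smul_set_iff]
    apply key
    obtain ⟨P, hP, hP'⟩ := hg
    exact ⟨g⁻¹ • P, Set.smul_mem_smul_set hP', by rwa [Set.mem_smul_set_iff_inv_smul_mem] at hP⟩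

/-- The sets `{α}`, `σ \ {α}` and the complement of `σ` are nonempty and invariant under the
stabiliser of `α`. As there are exactly three orbits, each of these sets is a single orbit. -/
theorem exists_smul_of_isRankThree {ω : Fˣ} (hω : ∀ x : Fˣ, x ∈ Subgroup.zpowers ω) {r : ℕ}
    (hr : 0 < r) {G : Subgroup (GammaL F)} (h3 : IsRankThree (permGroupOn ω r G))
    (hne : ∃ P ∈ sigmaOf ω r e1, P ≠ alphaPt ω r) {P Q : Points ω r}
    (hP : P ≠ alphaPt ω r) (hQ : Q ≠ alphaPt ω r)
    (hPQ : P ∈ sigmaOf ω r e1 ↔ Q ∈ sigmaOf ω r e1) :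
    ∃ g ∈ G, g • alphaPt ω r = alphaPt ω r ∧ g • P = Q := by
  classical
  let f : Points ω r → Fin 3 := fun P =>
    if P = alphaPt ω r then 0 else if P ∈ sigmaOf ω r e1 then 1 else 2
  have hcard := h3.2.2 (alphaPt ω r)
  have hstab : ∀ h ∈ MulAction.stabilizer (permGroupOn ω r G) (alphaPt ω r),
      ∃ g ∈ G, g • alphaPt ω r = alphaPt ω r ∧
        ∀ P : Points ω r, h • P = g • P := by
    rintro ⟨h, g, rfl⟩ hh
    exact ⟨g.1, g.2, hh, fun P => rfl⟩
  have hsig : ∀ g : GammaL F, g • alphaPt ω r = alphaPt ω r → ∀ P : Points ω r,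
      P ∈ sigmaOf ω r e1 → g • P ∈ sigmaOf ω r e1 := by
    intro g hg P hP
    obtain ⟨c, hc, hce⟩ := apply_e1_of_smul_alphaPt hg
    rw [mem_sigmaOf_iff hω hr] at hP ⊢
    obtain ⟨d, hd⟩ := hP
    refine ⟨unitsAutHom F (semAut g) d * c, ?_⟩
    change g.1 '' P.1 = _
    rw [hd, image_omr, gammaL_map_smul, hce, smul_smul]
    rfl
  have hinv : ∀ g : GammaL F, g • alphaPt ω r = alphaPt ω r → ∀ P : Points ω r,
      f (g • P) = f P := by
    intro g hg P
    have hg' : g⁻¹ • alphaPt ω r = alphaPt ω r := by rw [inv_smul_eq_iff, hg]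
    have h1 : g • P = alphaPt ω r ↔ P = alphaPt ω r := by
      rw [← eq_inv_smul_iff, hg']
    have h2 : g • P ∈ sigmaOf ω r e1 ↔ P ∈ sigmaOf ω r e1 :=
      ⟨fun h => by simpa using hsig _ hg' _ h, hsig g hg P⟩
    simp only [f, h1, h2]
  let F' : MulAction.orbitRel.Quotient
      (MulAction.stabilizer (permGroupOn ω r G) (alphaPt ω r)) (Points ω r) → Fin 3 :=
    Quotient.lift f (by
      rintro P Q ⟨h, rfl⟩
      obtain ⟨g, -, hg, hgP⟩ := hstab h.1 h.2
      exact (congrArg f (hgP Q)).trans (hinv g hg Q))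
  have hsurj : Function.Surjective F' := by
    intro i
    have : ∃ P, f P = i := by
      fin_cases i
      · exact ⟨alphaPt ω r, by simp [f]⟩
      · obtain ⟨P, hP, hPa⟩ := hne
        exact ⟨P, by simp [f, hP, hPa]⟩
      · refine ⟨affPt ω r 0 1, ?_⟩
        have h1 := affPt_notMem_sigmaOf hω hr 0 1
        have h2 : affPt ω r 0 1 ≠ alphaPt ω r := fun h => h1 (h ▸ alphaPt_mem_sigmaOf hω hr)
        simp [f, h1, h2]
    obtain ⟨P, hP⟩ := this
    exact ⟨Quotient.mk _ P, hP⟩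
  have hfin : Finite (MulAction.orbitRel.Quotient
      (MulAction.stabilizer (permGroupOn ω r G) (alphaPt ω r)) (Points ω r)) :=
    Nat.finite_of_card_ne_zero (by rw [hcard]; norm_num)
  have hinj : Function.Injective F' :=
    (hsurj.bijective_of_nat_card_le (by rw [hcard]; simp)).1
  have hf : f P = f Q := by simp only [f, hP, hQ, hPQ, if_false]
  have hrel := Quotient.exact (hinj (a₁ := Quotient.mk _ Q) (a₂ := Quotient.mk _ P) hf.symm)
  obtain ⟨h, hh⟩ := hrel
  obtain ⟨g, hg, hga, hgP⟩ := hstab h.1 h.2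
  exact ⟨g, hg, hga, (hgP P).symm.trans hh⟩

end StabilizerAction

/-! ### Arithmetic -/

section Arithmetic

theorem four_mul_add_two_lt_two_pow : ∀ m : ℕ, 5 ≤ m → 4 * m + 2 < 2 ^ m := by
  intro m hm
  induction m, hm using Nat.le_induction with
  | base => norm_num
  | succ m hm ih => rw [pow_succ]; omega

/-- The divisibility gives `p ^ a ≤ 2 r + 1 ≤ 2 a + 3`, so only small cases remain. These are the
fields in which the scalar determinant `ω^(2r)` is trivial. -/
theorem arith_two_mul {p a r : ℕ} (hp : p.Prime) (ha : 1 ≤ a) (h3 : p ^ a ≠ 3) (hr : r.Prime)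
    (hra : r ≤ a + 1) (hrq : r ∣ p ^ a - 1) (h : p ^ a - 1 ∣ 2 * r) :
    (p = 2 ∧ a = 2 ∧ r = 3) ∨ (p = 5 ∧ a = 1 ∧ r = 2) := by
  have h2 := hp.two_le
  have hle := Nat.le_of_dvd (by have := hr.pos; omega) h
  have hpa : 2 ^ a ≤ p ^ a := Nat.pow_le_pow_left h2 a
  have ha5 : a < 5 := by
    by_contra hc
    have := four_mul_add_two_lt_two_pow a (by omega)
    omega
  have hr2 := hr.two_le
  interval_cases a
  · have : p ≤ 5 := by simp at hle; omega
    interval_cases p <;> interval_cases r <;> simp_all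
  · have : p ≤ 2 := by
      have : p ^ 2 ≤ 7 := by omega
      nlinarith
    interval_cases p
    interval_cases r <;> simp_all
  · have : p ≤ 2 := by
      by_contra hc
      have : 3 ^ 3 ≤ p ^ 3 := Nat.pow_le_pow_left (by omega) 3
      omega
    interval_cases p
    interval_cases r <;> simp_all
  · omega

/-- Put `m = b (n - 1)`. Comparing sizes gives `p ^ m ≤ 2 r ≤ 2 (b n + 1) ≤ 4 m + 2`, because `b ≤
m`. Exponential growth bounds `m`, and a finite search finishes. In the proof `n` is shifted by `2`,
so `m` appears as `b * (n + 1)`. -/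
theorem arith_subfield {p b n r : ℕ} (hp : p.Prime) (hb : 1 ≤ b) (hn : 2 ≤ n) (hr : r.Prime)
    (hra : r ≤ b * n + 1) (hrq : r ∣ p ^ (b * n) - 1)
    (h : p ^ (b * n) - 1 ∣ 2 * r * (p ^ b - 1)) :
    n = 2 ∧ ((p = 2 ∧ b = 1 ∧ r = 3) ∨ (p = 2 ∧ b = 2 ∧ r = 5) ∨ (p = 3 ∧ b = 2 ∧ r = 5) ∨
      (p = 5 ∧ b = 1 ∧ r = 3) ∨ (p = 3 ∧ b = 1 ∧ r = 2)) := by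
  obtain ⟨n, rfl⟩ := Nat.exists_eq_add_of_le' hn
  have h2 := hp.two_le
  have hr2 := hr.two_le
  have hpb : 2 ≤ p ^ b := h2.trans (Nat.le_self_pow (by omega) p)
  have hle := Nat.le_of_dvd (Nat.mul_pos (by omega) (by omega)) h
  have hb1 : b ≤ b * (n + 1) := Nat.le_mul_of_pos_right b (by omega)
  have hsum : b * (n + 2) = b * (n + 1) + b := by ring
  have hpm : p ^ (b * (n + 1)) ≤ 2 * r := by
    rw [hsum, pow_add] at hle
    have h1 : 1 ≤ p ^ (b * (n + 1)) := Nat.one_le_pow _ _ (by omega)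
    obtain ⟨x, hx⟩ : ∃ x, p ^ b = x + 1 := ⟨p ^ b - 1, by omega⟩
    rw [hx] at hle hpb
    simp only [Nat.add_sub_cancel] at hle
    by_contra hc
    push Not at hc
    have h3 : (2 * r + 1) * x ≤ p ^ (b * (n + 1)) * x := Nat.mul_le_mul_right x hc
    have h4 : p ^ (b * (n + 1)) * (x + 1) = p ^ (b * (n + 1)) * x + p ^ (b * (n + 1)) := by ring
    have h5 : (2 * r + 1) * x = 2 * r * x + x := by ring
    omega
  have hp2 : 2 ^ (b * (n + 1)) ≤ p ^ (b * (n + 1)) := Nat.pow_le_pow_left h2 _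
  have hm5 : b * (n + 1) < 5 := by
    by_contra hc
    have := four_mul_add_two_lt_two_pow _ (not_lt.1 hc)
    omega
  have hb4 : b ≤ 4 := by omega
  have hn4 : n ≤ 3 := by nlinarith
  have hp5 : p ≤ 18 := by
    have : p ^ 1 ≤ p ^ (b * (n + 1)) := Nat.pow_le_pow_right (by omega) (by omega)
    rw [pow_one] at this
    omega
  have hpm' : p ^ (b * (n + 1)) ≤ 4 * (b * (n + 1)) + 2 := by omega
  have hra' : r ≤ 9 := by omega
  clear hle hp2 hpb hsum hb1
  interval_cases b <;> interval_cases n <;> simp at hm5 hpm' hra hra' <;>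
    interval_cases p <;> simp at hpm' hp <;> interval_cases r <;> simp_all

end Arithmetic

/-! ### Levels: the multiplicative group modulo `⟨ωʳ⟩` -/

section Levels

set_option linter.unusedSectionVars false

variable {F : Type*} [Field F] [Finite F] {ω : Fˣ}

theorem orderOf_generator (hω : ∀ x : Fˣ, x ∈ Subgroup.zpowers ω) :
    orderOf ω = Nat.card F - 1 := by
  rw [orderOf_eq_card_of_forall_mem_zpowers hω, Nat.card_units]

theorem zpow_generator_mem_iff (hω : ∀ x : Fˣ, x ∈ Subgroup.zpowers ω) {r : ℕ}
    (hrq : r ∣ Nat.card F - 1) (m : ℤ) : ω ^ m ∈ Subgroup.zpowers (ω ^ r) ↔ (r : ℤ) ∣ m := by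
  constructor
  · rintro ⟨k, hk⟩
    have hk : (ω ^ r) ^ k = ω ^ m := hk
    rw [← zpow_natCast ω r, ← zpow_mul, zpow_eq_zpow_iff_modEq, orderOf_generator hω] at hk
    have h1 := hk.dvd
    have h2 : (r : ℤ) ∣ m - r * k := (Int.natCast_dvd_natCast.2 hrq).trans h1
    simpa using dvd_add h2 (dvd_mul_right (r : ℤ) k)
  · rintro ⟨k, rfl⟩
    exact ⟨k, by simp [zpow_mul]⟩

theorem pow_generator_mem_iff (hω : ∀ x : Fˣ, x ∈ Subgroup.zpowers ω) {r : ℕ}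
    (hrq : r ∣ Nat.card F - 1) (m : ℕ) : ω ^ m ∈ Subgroup.zpowers (ω ^ r) ↔ r ∣ m := by
  rw [← zpow_natCast ω m, zpow_generator_mem_iff hω hrq, Int.natCast_dvd_natCast]

theorem zpow_div_zpow_mem_iff (hω : ∀ x : Fˣ, x ∈ Subgroup.zpowers ω) {r : ℕ}
    (hrq : r ∣ Nat.card F - 1) (m n : ℤ) :
    ω ^ m / ω ^ n ∈ Subgroup.zpowers (ω ^ r) ↔ (r : ℤ) ∣ m - n := by
  rw [div_eq_mul_inv, ← zpow_sub, zpow_generator_mem_iff hω hrq]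

theorem exists_pow_eq (hω : ∀ x : Fˣ, x ∈ Subgroup.zpowers ω) (u : Fˣ) : ∃ n : ℕ, u = ω ^ n := by
  obtain ⟨n, hn⟩ := mem_powers_iff_mem_zpowers.2 (hω u)
  exact ⟨n, hn.symm⟩

theorem exists_aut_eq_zpow (hω : ∀ x : Fˣ, x ∈ Subgroup.zpowers ω) (τ : RingAut F) :
    ∃ k : ℤ, ∀ x, unitsAutHom F τ x = x ^ k := by
  have : IsCyclic Fˣ := ⟨ω, hω⟩
  exact MonoidHom.map_cyclic (unitsAutHom F τ).toMonoidHom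

theorem ringAut_ext {τ σ : RingAut F} (hω : ∀ x : Fˣ, x ∈ Subgroup.zpowers ω)
    (h : unitsAutHom F τ ω = unitsAutHom F σ ω) : τ = σ := by
  refine RingEquiv.ext fun x => ?_
  by_cases hx : x = 0
  · rw [hx, map_zero, map_zero]
  · obtain ⟨m, hm⟩ := Subgroup.mem_zpowers_iff.1 (hω (Units.mk0 x hx))
    have h1 : unitsAutHom F τ (Units.mk0 x hx) = unitsAutHom F σ (Units.mk0 x hx) := by
      rw [← hm, map_zpow, map_zpow, h]
    exact congrArg Units.val h1

theorem ringAut_mul_comm (τ σ : RingAut F) : τ * σ = σ * τ := by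
  obtain ⟨ω, hω⟩ := IsCyclic.exists_generator (α := Fˣ)
  obtain ⟨k, hk⟩ := exists_aut_eq_zpow hω τ
  obtain ⟨l, hl⟩ := exists_aut_eq_zpow hω σ
  refine ringAut_ext hω ?_
  rw [map_mul, map_mul, MulAut.mul_apply, MulAut.mul_apply, hk, hl, hk, hl, ← zpow_mul,
    ← zpow_mul, mul_comm]

/-- Every automorphism fixes the prime field, so it lies in the Galois group over `ZMod p`, whose
elements are the Frobenius powers with exponent below the degree. -/
theorem exists_frobAut_pow (p : ℕ) [Fact p.Prime] [CharP F p] {a : ℕ}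
    (ha : Nat.card F = p ^ a) (τ : RingAut F) : ∃ j < a, τ = frobAut F p ^ j := by
  let _ := ZMod.algebra F p
  have _ : Fintype F := Fintype.ofFinite F
  let τ' : Gal(F/ZMod p) := AlgEquiv.ofRingEquiv (f := τ) fun x =>
    congrFun (congrArg DFunLike.coe (Subsingleton.elim
      ((τ : F →+* F).comp (algebraMap (ZMod p) F)) (algebraMap (ZMod p) F))) x
  obtain ⟨⟨j, hj⟩, h⟩ := (FiniteField.bijective_frobeniusAlgEquivOfAlgebraic_pow (ZMod p) F).2 τ'
  have hfin : Module.finrank (ZMod p) F = a := by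
    have h1 : p ^ Module.finrank (ZMod p) F = p ^ a := by
      rw [← ha, Module.natCard_eq_pow_finrank (K := ZMod p), Nat.card_zmod]
    exact Nat.pow_right_injective (Fact.out : p.Prime).two_le h1
  refine ⟨j, hfin ▸ hj, RingEquiv.ext fun x => ?_⟩
  have h2 : ∀ (n : ℕ) (x : F), (FiniteField.frobeniusAlgEquivOfAlgebraic (ZMod p) F ^ n) x =
      (frobAut F p ^ n) x := by
    intro n
    induction n with
    | zero => intro x; rfl
    | succ n ih =>
      intro x
      rw [pow_succ, pow_succ, AlgEquiv.mul_apply, RingAut.mul_apply, ih]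
      congr 1
      change x ^ Fintype.card (ZMod p) = x ^ p
      rw [ZMod.card]
  rw [← h2]
  exact (congrArg (fun e : Gal(F/ZMod p) => e x) h).symm

/-- The group of levels is cyclic of prime order `r`, so any nontrivial level generates it. -/
theorem exists_pow_div_mem (hω : ∀ x : Fˣ, x ∈ Subgroup.zpowers ω) {r : ℕ} (hr : r.Prime)
    (hrq : r ∣ Nat.card F - 1) {v : Fˣ} (hv : v ∉ Subgroup.zpowers (ω ^ r)) (u : Fˣ) :
    ∃ n : ℕ, u / v ^ n ∈ Subgroup.zpowers (ω ^ r) := by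
  obtain ⟨m, rfl⟩ := exists_pow_eq hω v
  obtain ⟨e, rfl⟩ := exists_pow_eq hω u
  rw [pow_generator_mem_iff hω hrq] at hv
  have := Fact.mk hr
  have hm : (m : ZMod r) ≠ 0 := by rwa [Ne, ZMod.natCast_eq_zero_iff]
  refine ⟨((e : ZMod r) * (m : ZMod r)⁻¹).val, ?_⟩
  rw [← pow_mul, ← zpow_natCast ω e, ← zpow_natCast ω (m * _),
    zpow_div_zpow_mem_iff hω hrq, ← ZMod.intCast_zmod_eq_zero_iff_dvd]
  push_cast
  rw [ZMod.natCast_val, ZMod.cast_id', id]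
  field_simp
  ring

/-- The conditions on a group of pairs (determinant, automorphism) that rank three amounts to. -/
structure IsRankThreeDetAut (ω : Fˣ) (r : ℕ) (H : Subgroup (DetAut F)) : Prop where
  /-- `H` is transitive on levels. -/
  transitive : ∀ u : Fˣ, ∃ s ∈ H, u / s.left ∈ Subgroup.zpowers (ω ^ r)
  /-- The automorphisms in `H` are transitive on nontrivial levels. -/
  transitive_aut : ∀ u : Fˣ, u ∉ Subgroup.zpowers (ω ^ r) →
    ∃ s ∈ H, u / unitsAutHom F s.right ω ∈ Subgroup.zpowers (ω ^ r)
  /-- `H` contains the scalars. -/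
  sq_mem : SemidirectProduct.inl ((ω ^ r) ^ 2) ∈ H

/-- Moving `(0, 1)` to `(0, u)` off the axis gives transitivity on levels. On the axis, `g` sends `ω
e₁` to `τ(ω) c e₁` with `c ∈ ⟨ωʳ⟩`, so only the automorphism `τ` affects the level there. -/
theorem isRankThreeDetAut_of_isRankThree (hω : ∀ x : Fˣ, x ∈ Subgroup.zpowers ω) {r : ℕ}
    (hr : 1 < r) (hrq : r ∣ Nat.card F - 1) {G : Subgroup (GammaL F)} (hG : YSL2 ω r ≤ G)
    (h3 : IsRankThree (permGroupOn ω r G)) : IsRankThreeDetAut ω r (G.map detAut) := by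
  have hr0 : 0 < r := by omega
  have hce : ∀ c : Fˣ, (c : F) • (e1 : Fin 2 → F) ≠ 0 := fun c =>
    smul_ne_zero c.ne_zero e1_ne_zero
  have hmem : ∀ c : Fˣ, point ω r _ (hce c) ∈ sigmaOf ω r e1 := fun c =>
    (mem_sigmaOf_iff hω hr0 _ _).2 ⟨c, rfl⟩
  have hne : ∀ c : Fˣ, c ∉ Subgroup.zpowers (ω ^ r) → point ω r _ (hce c) ≠ alphaPt ω r := by
    intro c hc h
    obtain ⟨d, hd, h⟩ := (point_eq_iff ω r _ _).1 h.symm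
    have h0 := congrFun h 0
    simp only [e1, Pi.smul_apply, Matrix.cons_val_zero, smul_eq_mul, mul_one] at h0
    exact hc (by rwa [Units.ext h0])
  have hω1 : ω ∉ Subgroup.zpowers (ω ^ r) := by
    have := pow_generator_mem_iff hω hrq 1
    rw [pow_one] at this
    rw [this, Nat.dvd_one]
    omega
  have hne' : ∃ P ∈ sigmaOf ω r e1, P ≠ alphaPt ω r := ⟨_, hmem ω, hne ω hω1⟩
  have haff : ∀ x u, affPt ω r x u ≠ alphaPt ω r := fun x u h =>
    affPt_notMem_sigmaOf hω hr0 x u (h ▸ alphaPt_mem_sigmaOf hω hr0)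
  refine ⟨fun u => ?_, fun u hu => ?_, inl_sq_mem_of_YSL2_le hG⟩
  · obtain ⟨g, hg, hga, hgP⟩ := exists_smul_of_isRankThree hω hr0 h3 hne' (haff 0 1) (haff 0 u)
      (by simp [affPt_notMem_sigmaOf hω hr0])
    obtain ⟨s, hs, t, hst⟩ := exists_affAct hG hg hga
    rw [hst, affPt_eq_iff] at hgP
    exact ⟨s, hs, by simpa [affAct] using hgP.2⟩
  · obtain ⟨g, hg, hga, hgP⟩ := exists_smul_of_isRankThree hω hr0 h3 hne' (hne ω hω1) (hne u hu)
      (by simp [hmem])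
    obtain ⟨c, hc, hce⟩ := apply_e1_of_smul_alphaPt hga
    refine ⟨detAut g, Subgroup.mem_map_of_mem _ hg, ?_⟩
    rw [smul_point] at hgP
    obtain ⟨l, hl, h⟩ := (point_eq_iff ω r _ _).1 hgP
    rw [gammaL_map_smul, hce] at h
    have h0 := congrFun h 0
    simp only [e1, Pi.smul_apply, Matrix.cons_val_zero, smul_eq_mul, mul_one] at h0
    have h1 : u = l * (unitsAutHom F (detAut g).right ω * c) := Units.ext h0
    rw [h1]
    have h2 : l * (unitsAutHom F (detAut g).right ω * c) / unitsAutHom F (detAut g).right ω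
        = l * c := by
      rw [div_eq_iff_eq_mul]; ac_rfl
    rw [h2]
    exact mul_mem hl hc

variable {r : ℕ} {H : Subgroup (DetAut F)}

/-- An automorphism acts on `Fˣ` as a power map whose exponent `k` is invertible modulo `r`. If it
carries the level of `ω` to that of `ω ^ i`, then `k ≡ i` modulo `r`; so a divisor `i` of `r` with
`1 < i < r` would divide the invertible `k`. -/
theorem IsRankThreeDetAut.prime (hH : IsRankThreeDetAut ω r H)
    (hω : ∀ x : Fˣ, x ∈ Subgroup.zpowers ω) (hr : 1 < r) (hrq : r ∣ Nat.card F - 1) :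
    r.Prime := by
  refine Nat.prime_def_lt'.2 ⟨hr, fun i hi hir hdvd => ?_⟩
  have hu : ω ^ i ∉ Subgroup.zpowers (ω ^ r) := by
    rw [pow_generator_mem_iff hω hrq]
    exact Nat.not_dvd_of_pos_of_lt (by omega) hir
  obtain ⟨s, -, hs⟩ := hH.transitive_aut _ hu
  obtain ⟨k, hk⟩ := exists_aut_eq_zpow hω s.right
  obtain ⟨k', hk'⟩ := exists_aut_eq_zpow hω s.right⁻¹
  have h1 : ω ^ (k' * k) = ω ^ (1 : ℤ) := by
    rw [zpow_mul, ← hk', ← hk, ← MulAut.mul_apply, ← map_mul, mul_inv_cancel, map_one, zpow_one]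
    rfl
  rw [zpow_eq_zpow_iff_modEq, orderOf_generator hω] at h1
  have h2 : (r : ℤ) ∣ 1 - k' * k := (Int.natCast_dvd_natCast.2 hrq).trans h1.dvd
  rw [hk, ← zpow_natCast ω i, zpow_div_zpow_mem_iff hω hrq] at hs
  have hi' : (i : ℤ) ∣ r := Int.natCast_dvd_natCast.2 hdvd
  have h3 : (i : ℤ) ∣ k := by
    have := (dvd_refl (i : ℤ)).sub (hi'.trans hs)
    simpa using this
  have h4 : (i : ℤ) ∣ 1 := by
    have := (hi'.trans h2).add (h3.mul_left k')
    simpa using this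
  have := Int.le_of_dvd one_pos h4
  omega

/-- Each of the `r - 1` nontrivial levels is the image of the level of `ω` under one of the `a`
Frobenius powers, and distinct levels need distinct powers. In case of equality every power is used.
-/
theorem IsRankThreeDetAut.le_add_one (hH : IsRankThreeDetAut ω r H)
    (hω : ∀ x : Fˣ, x ∈ Subgroup.zpowers ω) (hrq : r ∣ Nat.card F - 1)
    (p : ℕ) [Fact p.Prime] [CharP F p] {a : ℕ} (ha : Nat.card F = p ^ a) :
    r ≤ a + 1 ∧ (r = a + 1 → ∀ τ : RingAut F, ∃ s ∈ H, s.right = τ) := by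
  have h : ∀ i ∈ Finset.Ioo 0 r, ∃ j < a, ∃ s ∈ H, s.right = frobAut F p ^ j ∧
      ω ^ i / unitsAutHom F s.right ω ∈ Subgroup.zpowers (ω ^ r) := by
    intro i hi
    rw [Finset.mem_Ioo] at hi
    have hu : ω ^ i ∉ Subgroup.zpowers (ω ^ r) := by
      rw [pow_generator_mem_iff hω hrq]
      exact Nat.not_dvd_of_pos_of_lt hi.1 hi.2
    obtain ⟨s, hs, hs'⟩ := hH.transitive_aut _ hu
    obtain ⟨j, hj, hjs⟩ := exists_frobAut_pow p ha s.right
    exact ⟨j, hj, s, hs, hjs, hs'⟩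
  choose! f hfa s hs hsf hsω using h
  have hinj : Set.InjOn f (Finset.Ioo 0 r) := by
    intro i hi j hj hij
    have h1 := hsω i hi
    have h2 := hsω j hj
    rw [hsf j hj, ← hij, ← hsf i hi] at h2
    have h3 := div_mem h1 h2
    rw [div_div_div_cancel_right, ← zpow_natCast ω i, ← zpow_natCast ω j,
      zpow_div_zpow_mem_iff hω hrq] at h3
    simp only [Finset.coe_Ioo, Set.mem_Ioo] at hi hj
    have := Int.eq_zero_of_abs_lt_dvd h3 (by rw [abs_lt]; omega)
    omega
  have hmaps : ∀ i ∈ Finset.Ioo 0 r, f i ∈ Finset.range a := fun i hi =>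
    Finset.mem_range.2 (hfa i hi)
  have hcard := Finset.card_le_card_of_injOn f hmaps hinj
  rw [Nat.card_Ioo, Finset.card_range] at hcard
  refine ⟨by omega, fun hra τ => ?_⟩
  obtain ⟨j, hj, rfl⟩ := exists_frobAut_pow p ha τ
  have himg : (Finset.Ioo 0 r).image f = Finset.range a := by
    refine Finset.eq_of_subset_of_card_le (Finset.image_subset_iff.2 hmaps) ?_
    rw [Finset.card_image_of_injOn hinj, Nat.card_Ioo, Finset.card_range]
    omega
  have hj' := Finset.mem_range.2 hj
  rw [← himg, Finset.mem_image] at hj'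
  obtain ⟨i, hi, rfl⟩ := hj'
  exact ⟨s i, hs i hi, hsf i hi⟩

/-- Automorphisms commute, so commutators in `H` are pure determinants. For `r ≥ 3` the level of `ω
^ 2` is nontrivial, so some `s ∈ H` has an automorphism that squares levels. A suitable commutator
with a conjugate of `s` then has the level of `ω`, which generates all levels. -/
theorem IsRankThreeDetAut.exists_inl (hH : IsRankThreeDetAut ω r H)
    (hω : ∀ x : Fˣ, x ∈ Subgroup.zpowers ω) (hr : r.Prime) (hr3 : 3 ≤ r)
    (hrq : r ∣ Nat.card F - 1) (u : Fˣ) :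
    ∃ d : Fˣ, SemidirectProduct.inl d ∈ H ∧ u / d ∈ Subgroup.zpowers (ω ^ r) := by
  let π := QuotientGroup.mk' (Subgroup.zpowers (ω ^ r))
  have hπ : ∀ x y : Fˣ, x / y ∈ Subgroup.zpowers (ω ^ r) ↔ π x = π y := fun x y => by
    exact QuotientGroup.eq_iff_div_mem.symm
  have hr' : ∀ x : Fˣ, π x ^ (r : ℤ) = 1 := by
    intro x
    obtain ⟨m, rfl⟩ := hω x
    have : π ((ω ^ m) ^ (r : ℤ)) = π 1 := by
      rw [← hπ, div_one]
      exact ⟨m, by simp only [zpow_natCast]; rw [← zpow_natCast, ← zpow_natCast, ← zpow_mul,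
        ← zpow_mul, mul_comm]⟩
    simpa using this
  have h2 : ω ^ 2 ∉ Subgroup.zpowers (ω ^ r) := by
    rw [pow_generator_mem_iff hω hrq]
    exact Nat.not_dvd_of_pos_of_lt (by omega) (by omega)
  obtain ⟨s, hs, hs2⟩ := hH.transitive_aut _ h2
  obtain ⟨k, hk⟩ := exists_aut_eq_zpow hω s.right
  have hk2 : ∀ x : Fˣ, π (unitsAutHom F s.right x) = π x ^ 2 := by
    rw [hk, ← zpow_natCast ω 2, zpow_div_zpow_mem_iff hω hrq] at hs2
    obtain ⟨j, hj⟩ := hs2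
    intro x
    have : k = 2 - r * j := by push_cast at hj; omega
    rw [hk, map_zpow, this, zpow_sub, zpow_mul, hr', one_zpow, inv_one, mul_one]
    rfl
  -- On levels `s` acts as `u ↦ s.left * u ^ 2`, with fixed level `s.left⁻¹`. Conjugating by an
  -- element that sends the trivial level there gives `s'` with trivial level.
  obtain ⟨h, hh, hhd⟩ := hH.transitive s.left⁻¹
  rw [hπ] at hhd
  obtain ⟨w, hw, hwd⟩ := hH.transitive ω
  rw [hπ] at hwd
  let s' := h⁻¹ * (s * h)
  have hs' : s' ∈ H := mul_mem (inv_mem hh) (mul_mem hs hh)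
  have hs'r : s'.right = s.right := by
    change h.right⁻¹ * (s.right * h.right) = s.right
    rw [ringAut_mul_comm s.right, inv_mul_cancel_left]
  have hs'l : π s'.left = 1 := by
    obtain ⟨k', hk'⟩ := exists_aut_eq_zpow hω h.right⁻¹
    change π (unitsAutHom F h.right⁻¹ h.left⁻¹ *
      unitsAutHom F h.right⁻¹ (s.left * unitsAutHom F s.right h.left)) = 1
    rw [← map_mul, hk', map_zpow, map_mul, map_mul, hk2, map_inv, ← hhd, map_inv]
    simp
    group
  -- Modulo `⟨ωʳ⟩` the determinant of this commutator is `w.left ^ 2 / w.left`, the level of `ω`.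
  let c := s' * w * (w * s')⁻¹
  have hc : c ∈ H := mul_mem (mul_mem hs' hw) (inv_mem (mul_mem hw hs'))
  have hcr : c.right = 1 := by
    change s'.right * w.right * (w.right * s'.right)⁻¹ = 1
    rw [ringAut_mul_comm s'.right, mul_inv_cancel]
  have hcl : c.left * (w.left * unitsAutHom F w.right s'.left) =
      s'.left * unitsAutHom F s'.right w.left := by
    have h1 : (c * (w * s')).left = (s' * w).left :=
      congrArg _ (inv_mul_cancel_right (s' * w) (w * s'))
    rwa [SemidirectProduct.mul_left, hcr, map_one, MulAut.one_apply, SemidirectProduct.mul_left,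
      SemidirectProduct.mul_left] at h1
  have hcl' : π c.left = π ω := by
    obtain ⟨k', hk'⟩ := exists_aut_eq_zpow hω w.right
    have h1 := congrArg π hcl
    rw [map_mul, map_mul, map_mul, hs'r, hk2, hk', map_zpow, hs'l, ← hwd, one_zpow, one_mul,
      mul_one, pow_two] at h1
    exact mul_right_cancel h1
  have hcH : SemidirectProduct.inl c.left ∈ H := by
    convert hc
    exact SemidirectProduct.ext rfl hcr.symm
  have hcL : c.left ∉ Subgroup.zpowers (ω ^ r) := by
    intro hmem
    rw [← div_one c.left, hπ, hcl', ← hπ, div_one] at hmem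
    have := (pow_generator_mem_iff hω hrq 1).1 (by simpa using hmem)
    rw [Nat.dvd_one] at this
    omega
  obtain ⟨n, hn⟩ := exists_pow_div_mem hω hr hrq hcL u
  exact ⟨c.left ^ n, by rw [map_pow]; exact pow_mem hcH n, hn⟩

end Levels

/-! ### Multiplier fields of additive subgroups -/

section MultiplierField

set_option linter.unusedSectionVars false

variable {F : Type*} [Field F] [Finite F]

/-- The subfield of all `c` with `c A ⊆ A`. -/
def multiplierField (A : AddSubgroup F) : Subfield F where
  carrier := {c | ∀ x ∈ A, c * x ∈ A}
  mul_mem' := fun ha hb x hx => by rw [mul_assoc]; exact ha _ (hb x hx)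
  one_mem' := fun x hx => by rwa [one_mul]
  add_mem' := fun ha hb x hx => by rw [add_mul]; exact A.add_mem (ha x hx) (hb x hx)
  zero_mem' := fun x _ => by rw [zero_mul]; exact A.zero_mem
  neg_mem' := fun ha x hx => by rw [neg_mul]; exact A.neg_mem (ha x hx)
  inv_mem' := fun c hc => by
    have hpow : ∀ n : ℕ, ∀ x ∈ A, c ^ n * x ∈ A := by
      intro n
      induction n with
      | zero => intro x hx; simpa using hx
      | succ n ih => intro x hx; rw [pow_succ, mul_assoc]; exact ih _ (hc x hx)
    by_cases h0 : c = 0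
    · subst h0; simp
    · have hn := orderOf_pos (Units.mk0 c h0)
      have h1 : c ^ orderOf (Units.mk0 c h0) = 1 :=
        congrArg Units.val (pow_orderOf_eq_one (Units.mk0 c h0))
      have h2 : c⁻¹ = c ^ (orderOf (Units.mk0 c h0) - 1) := by
        rw [inv_eq_iff_eq_inv, eq_comm, inv_eq_of_mul_eq_one_right]
        rw [← pow_succ, Nat.sub_add_cancel hn, h1]
      rw [h2]
      exact hpow _

theorem mem_subfield_iff_pow_card (K : Subfield F) (c : F) : c ∈ K ↔ c ^ Nat.card K = c := by
  have _ : Fintype K := Fintype.ofFinite K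
  have hK : ∀ c ∈ K, c ^ Nat.card K = c := by
    intro c hc
    have := FiniteField.pow_card (⟨c, hc⟩ : K)
    rw [← Nat.card_eq_fintype_card] at this
    exact congrArg Subtype.val this
  refine ⟨hK c, fun h => ?_⟩
  classical
  have h1 : 1 < Nat.card K := Finite.one_lt_card
  have hne := FiniteField.X_pow_card_sub_X_ne_zero F h1
  let R := (Polynomial.X ^ Nat.card K - Polynomial.X : Polynomial F).roots.toFinset
  have hR : ∀ x : F, x ∈ R ↔ x ^ Nat.card K = x := fun x => by
    rw [Multiset.mem_toFinset, Polynomial.mem_roots hne]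
    simp [sub_eq_zero]
  have hsub : (K : Set F).toFinset ⊆ R := fun x hx => (hR x).2 (hK x (by simpa using hx))
  have hcard : R.card ≤ (K : Set F).toFinset.card := by
    refine (Multiset.toFinset_card_le _).trans ((Polynomial.card_roots' _).trans ?_)
    rw [FiniteField.X_pow_card_sub_X_natDegree_eq F h1, Set.toFinset_card,
      ← Nat.card_eq_fintype_card]
    rfl
  have := Finset.eq_of_subset_of_card_le hsub hcard
  have hc : c ∈ (K : Set F).toFinset := this ▸ (hR c).2 h
  simpa using hc

/-- If the multiplier field were all of `F`, then `A` would be an ideal of `F`, hence trivial or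
everything; so the degree is at least two. -/
theorem exists_card_multiplierField {A : AddSubgroup F} (h0 : A ≠ ⊥) (h1 : A ≠ ⊤)
    (p : ℕ) [Fact p.Prime] [CharP F p] : ∃ b n, 1 ≤ b ∧ 2 ≤ n ∧
      Nat.card (multiplierField A) = p ^ b ∧ Nat.card F = p ^ (b * n) := by
  have _ : Fintype (multiplierField A) := Fintype.ofFinite _
  obtain ⟨b, -, hb⟩ := FiniteField.card (multiplierField A) p
  have hF := Module.natCard_eq_pow_finrank (K := multiplierField A) (V := F)
  rw [← Nat.card_eq_fintype_card] at hb
  refine ⟨b, _, b.pos, ?_, hb, by rw [hF, hb, ← pow_mul]⟩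
  by_contra hn
  have hpos : 0 < Module.finrank (multiplierField A) F := Module.finrank_pos
  have hn1 : Module.finrank (multiplierField A) F = 1 := by omega
  rw [hn1, pow_one] at hF
  have htop : ∀ c : F, c ∈ multiplierField A := by
    intro c
    rw [mem_subfield_iff_pow_card, ← hF]
    have _ : Fintype F := Fintype.ofFinite F
    rw [Nat.card_eq_fintype_card, FiniteField.pow_card]
  obtain ⟨x, hx, hx0⟩ := A.bot_or_exists_ne_zero.resolve_left h0
  refine h1 (eq_top_iff.2 fun y _ => ?_)
  have := htop (y / x) x hx
  rwa [div_mul_cancel₀ _ hx0] at this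

/-- `F` is a plane over the multiplier field, so the proper nonzero subspace `A` is a line. An
element of `A` off the line through `c` would give `A` at least as many elements as `F`. -/
theorem eq_mulSubfield {A : AddSubgroup F} (h1 : A ≠ ⊤)
    (hq : Nat.card F = Nat.card (multiplierField A) ^ 2) {c : F} (hc : c ∈ A) (hc0 : c ≠ 0) :
    (A : Set F) = mulSubfield c (Nat.card (multiplierField A)) := by
  ext x
  constructor
  · intro hx
    refine ⟨x / c, ?_, by field_simp⟩
    rw [← mem_subfield_iff_pow_card]
    by_contra hxc
    refine h1 (eq_top_iff.2 ?_)
    let f : multiplierField A × multiplierField A → A := fun z =>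
      ⟨z.1 * c + z.2 * x, A.add_mem (z.1.2 c hc) (z.2.2 x hx)⟩
    have hf : Function.Injective f := by
      rintro ⟨a, b⟩ ⟨a', b'⟩ h
      have h : (a : F) * c + b * x = a' * c + b' * x := congrArg Subtype.val h
      have hb : b = b' := by
        by_contra hb
        have hb' : (b : F) - b' ≠ 0 := sub_ne_zero.2 fun h => hb (Subtype.ext h)
        apply hxc
        have h2 : x / c = ((a' : F) - a) / (b - b') := by
          rw [div_eq_div_iff hc0 hb']
          linear_combination h
        rw [h2]
        exact div_mem (sub_mem a'.2 a.2) (sub_mem b.2 b'.2)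
      subst hb
      have ha : (a : F) = a' := mul_right_cancel₀ hc0 (add_right_cancel h)
      rw [Subtype.ext ha]
    have hcard := Nat.card_le_card_of_injective f hf
    rw [Nat.card_prod, ← pow_two, ← hq] at hcard
    have := AddSubgroup.eq_top_of_le_card A hcard
    exact this.ge
  · rintro ⟨y, hy, rfl⟩
    rw [← mem_subfield_iff_pow_card] at hy
    rw [mul_comm]
    exact hy c hc

theorem ncard_mulSubfield (K : Subfield F) {c : F} (hc : c ≠ 0) :
    (mulSubfield c (Nat.card K)).ncard = Nat.card K := by
  have h : mulSubfield c (Nat.card K) = (fun y => c * y) '' (K : Set F) := by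
    ext x
    constructor
    · rintro ⟨y, hy, rfl⟩
      exact ⟨y, (mem_subfield_iff_pow_card K y).2 hy, rfl⟩
    · rintro ⟨y, hy, rfl⟩
      exact ⟨y, (mem_subfield_iff_pow_card K y).1 hy, rfl⟩
  rw [h, Set.ncard_image_of_injective _ (mul_right_injective₀ hc)]
  rfl

theorem mulSubfield_mul (c : F) {k : ℕ} (y : F) (hy : y ^ k = y) (hy0 : y ≠ 0) :
    mulSubfield (c * y) k = mulSubfield c k := by
  ext x
  constructor
  · rintro ⟨z, hz, rfl⟩
    exact ⟨y * z, by rw [mul_pow, hy, hz], by ring⟩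
  · rintro ⟨z, hz, rfl⟩
    exact ⟨z / y, by rw [div_pow, hy, hz], by field_simp⟩

end MultiplierField

/-! ### Blocks of the affine action -/

section AffineBlocks

set_option linter.unusedSectionVars false

variable {F : Type*} [Field F] [Finite F] {ω : Fˣ} {r : ℕ} {H : Subgroup (DetAut F)}
  {P : Set (F × Fˣ)}

/-- A block of the affine action, containing the base point `(0, 1)`. -/
structure IsBaseBlock (ω : Fˣ) (r : ℕ) (H : Subgroup (DetAut F)) (P : Set (F × Fˣ)) : Prop where
  /-- It is a block. -/
  block : IsAffBlock H P
  /-- It contains the base point. -/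
  zero_mem : (0, 1) ∈ P
  /-- It is a set of points. -/
  smul_mem : ∀ (x : F) (u l : Fˣ), l ∈ Subgroup.zpowers (ω ^ r) → (x, u) ∈ P → (x, l * u) ∈ P

theorem affAct_one (t x : F) (u : Fˣ) : affAct 1 t (x, u) = (x + t, u) := by
  simp [affAct]

theorem IsBaseBlock.add_fst_mem (hP : IsBaseBlock ω r H P) {x t : F} {u : Fˣ} (ht : (t, 1) ∈ P)
    (hx : (x, u) ∈ P) : (x + t, u) ∈ P := by
  have := hP.block 1 H.one_mem t ⟨_, hP.zero_mem, by rwa [affAct_one, zero_add]⟩ _ hx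
  rwa [affAct_one] at this

theorem IsBaseBlock.sub_fst_mem (hP : IsBaseBlock ω r H P) {x y : F} {u : Fˣ} (hx : (x, u) ∈ P)
    (hy : (y, u) ∈ P) : (y - x, 1) ∈ P := by
  have := hP.block 1 H.one_mem (y - x) ⟨_, hx, by rwa [affAct_one, add_sub_cancel]⟩ _ hP.zero_mem
  rwa [affAct_one, zero_add] at this

/-- The additive group of all `x` with `(x, 1)` in the block. -/
def IsBaseBlock.fiber (hP : IsBaseBlock ω r H P) : AddSubgroup F where
  carrier := {x | (x, 1) ∈ P}
  zero_mem' := hP.zero_mem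
  add_mem' := fun hx hy => hP.add_fst_mem hy hx
  neg_mem' := fun {x} hx => by simpa using hP.sub_fst_mem hx hP.zero_mem

theorem IsBaseBlock.mem_congr (hP : IsBaseBlock ω r H P) {x : F} {u w : Fˣ}
    (h : u / w ∈ Subgroup.zpowers (ω ^ r)) : (x, u) ∈ P ↔ (x, w) ∈ P := by
  constructor
  · intro hx
    have := hP.smul_mem x u _ (inv_mem h) hx
    rwa [inv_div, div_mul_cancel] at this
  · intro hx
    have := hP.smul_mem x w _ h hx
    rwa [div_mul_cancel] at this

theorem IsBaseBlock.affAct_mem (hP : IsBaseBlock ω r H P) {s : DetAut F} (hs : s ∈ H) {y : F}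
    (hy : (y, s.left) ∈ P) : ∀ z ∈ P, affAct s y z ∈ P :=
  hP.block s hs y ⟨_, hP.zero_mem, by simpa [affAct] using hy⟩

/-- The map with translation part `y` sends the base point to `(y, s.left)`, so it preserves the
block. The images of `(0, 1)` and `(x, 1)` lie on one level, and their difference is in the fibre.
-/
theorem IsBaseBlock.div_mem_fiber (hP : IsBaseBlock ω r H P) {s : DetAut F} (hs : s ∈ H) {y : F}
    (hy : (y, s.left) ∈ P) {x : F} (hx : x ∈ hP.fiber) :
    s.right x / s.left ∈ hP.fiber := by
  have h1 := hP.affAct_mem hs hy _ hx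
  simp only [affAct, map_one, mul_one] at h1
  have := hP.sub_fst_mem hy h1
  rwa [add_sub_cancel_right] at this

theorem IsBaseBlock.zero_mem_of_mem (hP : IsBaseBlock ω r H P) {u : Fˣ}
    (hu : u ∈ Subgroup.zpowers (ω ^ r)) : (0, u) ∈ P :=
  (hP.mem_congr (w := 1) (by simpa using hu)).2 hP.zero_mem

/-- For `r ≥ 3` a pure determinant `d` at the level of `v`, with translation part `y`, preserves the
block; iterating it from the base point reaches the levels of all `d ^ n`, which exhaust the levels.
For `r = 2` only two levels exist. -/
theorem IsBaseBlock.exists_mem (hP : IsBaseBlock ω r H P) (hH : IsRankThreeDetAut ω r H)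
    (hω : ∀ x : Fˣ, x ∈ Subgroup.zpowers ω) (hr : r.Prime) (hrq : r ∣ Nat.card F - 1)
    {y : F} {v : Fˣ} (hv : v ∉ Subgroup.zpowers (ω ^ r)) (hyv : (y, v) ∈ P) (u : Fˣ) :
    ∃ x, (x, u) ∈ P := by
  by_cases hr3 : 3 ≤ r
  · obtain ⟨d, hd, hvd⟩ := hH.exists_inl hω hr hr3 hrq v
    have hyd := (hP.mem_congr hvd).1 hyv
    have hdL : d ∉ Subgroup.zpowers (ω ^ r) := fun h => hv (by
      have := mul_mem hvd h
      rwa [div_mul_cancel] at this)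
    have hact := hP.affAct_mem (s := SemidirectProduct.inl d) hd hyd
    have hpow : ∀ n : ℕ, ∃ x, (x, d ^ n) ∈ P := by
      intro n
      induction n with
      | zero => exact ⟨0, by simpa using hP.zero_mem⟩
      | succ n ih =>
        obtain ⟨x, hx⟩ := ih
        refine ⟨(affAct (SemidirectProduct.inl d) y (x, d ^ n)).1, ?_⟩
        have := hact _ hx
        simpa [affAct, pow_succ'] using this
    obtain ⟨n, hn⟩ := exists_pow_div_mem hω hr hrq hdL u
    obtain ⟨x, hx⟩ := hpow n
    exact ⟨x, (hP.mem_congr hn).2 hx⟩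
  · have hr2 : r = 2 := by have := hr.two_le; omega
    by_cases hu : u ∈ Subgroup.zpowers (ω ^ r)
    · exact ⟨0, hP.zero_mem_of_mem hu⟩
    · refine ⟨y, (hP.mem_congr ?_).2 hyv⟩
      obtain ⟨m, rfl⟩ := Subgroup.mem_zpowers_iff.1 (hω u)
      obtain ⟨n, rfl⟩ := Subgroup.mem_zpowers_iff.1 (hω v)
      rw [zpow_generator_mem_iff hω hrq] at hu hv
      rw [zpow_div_zpow_mem_iff hω hrq]
      subst hr2
      push_cast at *
      omega

/-- The map `(x, u) ↦ (x / d, d u)` keeps the level of every point and fixes the base point up to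
`⟨ωʳ⟩`, so it preserves the block. Hence `x / d - x` is in the zero fibre, and `d ≠ 1` gives `x =
0`. -/
theorem IsBaseBlock.eq_axis (hP : IsBaseBlock ω r H P) (hbot : hP.fiber = ⊥)
    (hex : ∀ u, ∃ x, (x, u) ∈ P) {d : Fˣ} (hd : SemidirectProduct.inl d ∈ H)
    (hdL : d ∈ Subgroup.zpowers (ω ^ r)) (hd1 : d ≠ 1) : P = {z | z.1 = 0} := by
  have hzero : ∀ x u, (x, u) ∈ P → x = 0 := by
    intro x u hx
    have h1 := hP.affAct_mem (s := SemidirectProduct.inl d) hd (hP.zero_mem_of_mem hdL) _ hx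
    have h2 : (x / d, d * u) ∈ P := by simpa [affAct] using h1
    have h3 := (hP.mem_congr (w := u) (by simpa using hdL)).1 h2
    have h4 : x / d - x ∈ hP.fiber := hP.sub_fst_mem hx h3
    rw [hbot, AddSubgroup.mem_bot] at h4
    have hd0 : (d : F) ≠ 0 := d.ne_zero
    have h5 : x * (1 - d) = 0 := by
      field_simp at h4
      linear_combination h4
    rcases mul_eq_zero.1 h5 with h | h
    · exact h
    · exact absurd (Units.ext (sub_eq_zero.1 h).symm) hd1
  ext ⟨x, u⟩
  refine ⟨fun h => hzero x u h, fun h => ?_⟩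
  obtain ⟨y, hy⟩ := hex u
  have h : x = 0 := h
  rw [hzero y u hy] at hy
  rwa [h]

theorem IsBaseBlock.eq_lineSet (hP : IsBaseBlock ω r H P)
    (h : ∀ x u, (x, u) ∈ P → u ∈ Subgroup.zpowers (ω ^ r)) :
    P = {z | z.1 ∈ (hP.fiber : Set F) ∧ z.2 ∈ Subgroup.zpowers (ω ^ r)} := by
  ext ⟨x, u⟩
  constructor
  · intro hx
    exact ⟨(hP.mem_congr (by simpa using h x u hx)).1 hx, h x u hx⟩
  · rintro ⟨hx, hu⟩
    exact (hP.mem_congr (w := 1) (by simpa using hu)).2 hx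

theorem IsBaseBlock.eq_univ (hP : IsBaseBlock ω r H P) (htop : hP.fiber = ⊤)
    (hex : ∀ u, ∃ x, (x, u) ∈ P) : P = Set.univ := by
  refine Set.eq_univ_of_forall fun ⟨x, u⟩ => ?_
  obtain ⟨y, hy⟩ := hex u
  have : x - y ∈ hP.fiber := htop ▸ AddSubgroup.mem_top _
  simpa using hP.add_fst_mem this hy

/-- By `div_mem_fiber` the coset `c 𝔽_k` is stable under `x ↦ τ x / d`. Taking `x = c` puts `τ c /
(d c)` in `𝔽_k`. This is the constraint that determines `H` and `c` in the exceptional cases. -/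
theorem IsBaseBlock.pow_eq_one (hP : IsBaseBlock ω r H P) {c : Fˣ} {k : ℕ} (hk : 0 < k)
    (hA : (hP.fiber : Set F) = mulSubfield (c : F) k) {s : DetAut F} (hs : s ∈ H) {y : F}
    (hy : (y, s.left) ∈ P) : (unitsAutHom F s.right c / (s.left * c)) ^ (k - 1) = 1 := by
  have hc : (c : F) ∈ (hP.fiber : Set F) := by
    rw [hA]; exact ⟨1, one_pow _, (mul_one _).symm⟩
  have h1 : s.right (c : F) / s.left ∈ (hP.fiber : Set F) := hP.div_mem_fiber hs hy hc
  rw [hA] at h1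
  obtain ⟨z, hz, hzc⟩ := h1
  have hu : ((unitsAutHom F s.right c / (s.left * c) : Fˣ) : F) = z := by
    have hc0 : (c : F) ≠ 0 := c.ne_zero
    have hl0 : (s.left : F) ≠ 0 := s.left.ne_zero
    rw [Units.val_div_eq_div_val, coe_unitsAutHom, Units.val_mul, ← div_div, hzc]
    field_simp
  have h2 : (unitsAutHom F s.right c / (s.left * c)) ^ k =
      unitsAutHom F s.right c / (s.left * c) := by
    ext; rw [Units.val_pow_eq_pow_val, hu, hz]
  obtain ⟨k, rfl⟩ := Nat.exists_eq_add_of_le' hk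
  rw [pow_succ] at h2
  exact mul_eq_right.1 h2

end AffineBlocks

/-! ### Classification of the blocks of the affine action -/

section Classification

set_option linter.unusedSectionVars false

variable {F : Type*} [Field F] [Finite F] {ω : Fˣ} {r : ℕ} {H : Subgroup (DetAut F)}
  {P : Set (F × Fˣ)}

theorem zpow_generator_eq_one_iff (hω : ∀ x : Fˣ, x ∈ Subgroup.zpowers ω) {n : ℕ}
    (hn : Nat.card F = n + 1) (m : ℤ) : ω ^ m = 1 ↔ (n : ℤ) ∣ m := by
  rw [← orderOf_dvd_iff_zpow_eq_one, orderOf_generator hω, hn, Nat.add_sub_cancel]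

theorem unitsAutHom_frobAut (p : ℕ) [Fact p.Prime] [CharP F p] (x : Fˣ) :
    unitsAutHom F (frobAut F p) x = x ^ p := Units.ext (frobAut_apply p (x : F))

theorem inl_mul_eq (d : Fˣ) (s : DetAut F) :
    SemidirectProduct.inl d * s = ⟨d * s.left, s.right⟩ := by
  refine SemidirectProduct.ext ?_ ?_
  · rw [SemidirectProduct.mul_left, SemidirectProduct.left_inl, SemidirectProduct.right_inl,
      map_one, MulAut.one_apply]
  · rw [SemidirectProduct.mul_right, SemidirectProduct.right_inl, one_mul]

/-- The hypothesis on `j` says that the scalar determinants already generate `⟨ωʳ⟩`. With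
`exists_inl` all determinants lie in `H`, and `r = a + 1` supplies all automorphisms. -/
theorem IsRankThreeDetAut.eq_top (hH : IsRankThreeDetAut ω r H)
    (hω : ∀ x : Fˣ, x ∈ Subgroup.zpowers ω) (hr : r.Prime) (hr3 : 3 ≤ r)
    (hrq : r ∣ Nat.card F - 1) (p : ℕ) [Fact p.Prime] [CharP F p] {a : ℕ}
    (ha : Nat.card F = p ^ a) (hra : r = a + 1) {j : ℕ} (hj : ((ω ^ r) ^ 2) ^ j = ω ^ r) :
    H = ⊤ := by
  have hL : ∀ l ∈ Subgroup.zpowers (ω ^ r), SemidirectProduct.inl l ∈ H := by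
    rintro l ⟨m, rfl⟩
    change SemidirectProduct.inl ((ω ^ r) ^ m) ∈ H
    rw [map_zpow]
    refine Subgroup.zpow_mem _ ?_ m
    rw [← hj, map_pow]
    exact pow_mem hH.sq_mem j
  have hall : ∀ u : Fˣ, SemidirectProduct.inl u ∈ H := by
    intro u
    obtain ⟨d, hd, hud⟩ := hH.exists_inl hω hr hr3 hrq u
    have := mul_mem (hL _ hud) hd
    rwa [← map_mul, div_mul_cancel] at this
  refine eq_top_iff.2 fun s _ => ?_
  obtain ⟨t, ht, hts⟩ := (hH.le_add_one hω hrq p ha).2 hra s.right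
  have h1 : s = SemidirectProduct.inl (s.left / t.left) * t := by
    rw [inl_mul_eq, div_mul_cancel, hts]
  rw [h1]
  exact mul_mem (hall _) ht

/-- A proper nontrivial fibre is a multiple of a subfield of index two. -/
theorem IsBaseBlock.exists_fiber_eq (hP : IsBaseBlock ω r H P) (hH : IsRankThreeDetAut ω r H)
    (hω : ∀ x : Fˣ, x ∈ Subgroup.zpowers ω) (hr : r.Prime) (hrq : r ∣ Nat.card F - 1)
    (h0 : hP.fiber ≠ ⊥) (h1 : hP.fiber ≠ ⊤) (p : ℕ) [Fact p.Prime] [CharP F p] :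
    ∃ (k : ℕ) (c : Fˣ), (hP.fiber : Set F) = mulSubfield (c : F) k ∧
      (hP.fiber : Set F).ncard = k ∧ ((p = 2 ∧ Nat.card F = 4 ∧ r = 3 ∧ k = 2) ∨ (p = 2 ∧ Nat.card F = 16 ∧ r = 5 ∧ k = 4) ∨
        (p = 3 ∧ Nat.card F = 81 ∧ r = 5 ∧ k = 9) ∨
        (p = 5 ∧ Nat.card F = 25 ∧ r = 3 ∧ k = 5) ∨
        (p = 3 ∧ Nat.card F = 9 ∧ r = 2 ∧ k = 3)) := by
  obtain ⟨b, n, hb, hn, hcK, hcF⟩ := exists_card_multiplierField h0 h1 p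
  -- Scalars of `Y` keep the trivial level, so their determinants divide the fibre into itself.
  have hκ : (((ω ^ r) ^ 2 : Fˣ) : F) ∈ multiplierField hP.fiber := by
    rw [← inv_inv (((ω ^ r) ^ 2 : Fˣ) : F)]
    refine inv_mem fun x hx => ?_
    have hL : (ω ^ r) ^ 2 ∈ Subgroup.zpowers (ω ^ r) := pow_mem (Subgroup.mem_zpowers _) 2
    have := hP.div_mem_fiber hH.sq_mem (hP.zero_mem_of_mem hL) hx
    rwa [div_eq_inv_mul] at this
  rw [mem_subfield_iff_pow_card, hcK] at hκ
  have hpb : 1 ≤ p ^ b := Nat.one_le_pow _ _ (Fact.out : p.Prime).pos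
  have hpow : ((ω ^ r) ^ 2) ^ (p ^ b - 1) = 1 := by
    have h2 : ((ω ^ r) ^ 2) ^ (p ^ b) = (ω ^ r) ^ 2 := by
      ext; rw [Units.val_pow_eq_pow_val, hκ]
    rw [← Nat.sub_add_cancel hpb, pow_succ] at h2
    exact mul_eq_right.1 h2
  have hdvd : p ^ (b * n) - 1 ∣ 2 * r * (p ^ b - 1) := by
    rw [← pow_mul, ← pow_mul] at hpow
    have := orderOf_dvd_of_pow_eq_one hpow
    rwa [orderOf_generator hω, hcF,
      show r * (2 * (p ^ b - 1)) = 2 * r * (p ^ b - 1) by ring] at this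
  have hra := (hH.le_add_one hω hrq p hcF).1
  rw [hcF] at hrq
  obtain ⟨rfl, hcases⟩ := arith_subfield Fact.out hb hn hr hra hrq hdvd
  obtain ⟨c, hc, hc0⟩ := hP.fiber.bot_or_exists_ne_zero.resolve_left h0
  have hA := eq_mulSubfield h1 (by rw [hcF, hcK, pow_mul]) hc hc0
  have hcard := ncard_mulSubfield (multiplierField hP.fiber) hc0
  rw [← hA, hcK] at hcard
  rw [hcK] at hA
  refine ⟨_, Units.mk0 c hc0, hA, hcard, ?_⟩
  rw [hcF]
  rcases hcases with ⟨rfl, rfl, rfl⟩ | ⟨rfl, rfl, rfl⟩ | ⟨rfl, rfl, rfl⟩ | ⟨rfl, rfl, rfl⟩ |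
    ⟨rfl, rfl, rfl⟩ <;> norm_num

/-- If the fibre is a proper nontrivial subgroup then the block has only one level. -/
theorem IsBaseBlock.mem_zpowers_of_fiber (hP : IsBaseBlock ω r H P)
    (hH : IsRankThreeDetAut ω r H)
    (hω : ∀ x : Fˣ, x ∈ Subgroup.zpowers ω) (hr : r.Prime) (hrq : r ∣ Nat.card F - 1)
    (h0 : hP.fiber ≠ ⊥) (h1 : hP.fiber ≠ ⊤) (p : ℕ) [Fact p.Prime] [CharP F p] :
    ∀ x u, (x, u) ∈ P → u ∈ Subgroup.zpowers (ω ^ r) := by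
  intro y v hyv
  by_contra hv
  have hex := hP.exists_mem hH hω hr hrq hv hyv
  obtain ⟨k, c, hA, -, hcases⟩ := hP.exists_fiber_eq hH hω hr hrq h0 h1 p
  have hk : 0 < k := by omega
  obtain ⟨e, rfl⟩ := Subgroup.mem_zpowers_iff.1 (hω c)
  by_cases hr3 : 3 ≤ r
  -- Write `d = ω ^ m`, so `m ≡ 1` modulo `r`. The constraint `pow_eq_one` gives `q - 1 ∣ m (k -
  -- 1)`, and in the listed cases `r` divides `(q - 1) / (k - 1)`, which forces `r ∣ m`.
  · obtain ⟨d, hd, hωd⟩ := hH.exists_inl hω hr hr3 hrq ω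
    obtain ⟨x, hx⟩ := hex d
    obtain ⟨m, rfl⟩ := Subgroup.mem_zpowers_iff.1 (hω d)
    have h2 := hP.pow_eq_one hk hA hd hx
    have h3 := zpow_div_zpow_mem_iff hω hrq 1 m
    rw [zpow_one] at h3
    rw [h3] at hωd
    simp only [SemidirectProduct.right_inl, SemidirectProduct.left_inl, map_one,
      MulAut.one_apply, div_mul_cancel_right, ← zpow_neg, ← zpow_natCast, ← zpow_mul] at h2
    rcases hcases with ⟨-, hq, rfl, rfl⟩ | ⟨-, hq, rfl, rfl⟩ | ⟨-, hq, rfl, rfl⟩ |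
      ⟨-, hq, rfl, rfl⟩ | ⟨-, hq, rfl, rfl⟩
    all_goals
      rw [zpow_generator_eq_one_iff hω hq] at h2
      push_cast at * <;> omega
  · obtain ⟨rfl, hq, rfl, rfl⟩ : p = 3 ∧ Nat.card F = 9 ∧ r = 2 ∧ k = 3 := by omega
    -- Here `s.left = ω ^ m` with `m` odd. The constraint says that `8` divides `2 m` or `2 (2 e -
    -- m)`, according to the automorphism; both make `m` even.
    obtain ⟨s, hs, hωs⟩ := hH.transitive ω
    obtain ⟨x, hx⟩ := hex s.left
    have h2 := hP.pow_eq_one hk hA hs hx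
    obtain ⟨m, hm⟩ := Subgroup.mem_zpowers_iff.1 (hω s.left)
    have h3 := zpow_div_zpow_mem_iff hω hrq 1 m
    rw [zpow_one] at h3
    rw [← hm, h3] at hωs
    rw [← hm] at h2
    obtain ⟨j, hj, hjs⟩ := exists_frobAut_pow 3 (a := 2) (by rw [hq]; norm_num) s.right
    rw [hjs] at h2
    interval_cases j
    · rw [pow_zero] at h2
      simp only [map_one, MulAut.one_apply, div_mul_cancel_right, ← zpow_neg,
        ← zpow_natCast, ← zpow_mul] at h2
      rw [zpow_generator_eq_one_iff hω hq] at h2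
      push_cast at *
      omega
    · rw [pow_one] at h2
      simp only [unitsAutHom_frobAut, ← zpow_add, ← zpow_natCast, ← zpow_mul,
        div_eq_mul_inv, ← zpow_neg] at h2
      rw [zpow_generator_eq_one_iff hω hq] at h2
      push_cast at *
      omega

/-- The exceptional groups in the odd square case. -/
theorem IsBaseBlock.eq_squares_sup (hP : IsBaseBlock ω r H P) (hH : IsRankThreeDetAut ω r H)
    (hω : ∀ x : Fˣ, x ∈ Subgroup.zpowers ω) (hr : r.Prime) (hr3 : 3 ≤ r)
    (p : ℕ) [Fact p.Prime] [CharP F p] (hp : p ≠ 2) {a k : ℕ}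
    (ha : Nat.card F = p ^ a) (hra : r = a + 1) (hk : 2 ≤ k)
    (hq : Nat.card F = 2 * r * (k - 1) + 1) {e : ℤ}
    (hA : (hP.fiber : Set F) = mulSubfield ((ω ^ e : Fˣ) : F) k) :
    H = Subgroup.zpowers (SemidirectProduct.inl ((ω ^ 1) ^ 2)) ⊔
        Subgroup.zpowers (SemidirectProduct.inr (frobAut F p)) ∧
      (2 * r : ℤ) ∣ (p - 1) * e := by
  have hrq : r ∣ Nat.card F - 1 := by
    rw [hq, Nat.add_sub_cancel]
    exact ⟨2 * (k - 1), by ring⟩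
  have hk0 : ((k - 1 : ℕ) : ℤ) ≠ 0 := by omega
  have hrodd : ∃ r', r = 2 * r' + 1 := hr.odd_of_ne_two (by omega)
  obtain ⟨r', hr'⟩ := hrodd
  obtain ⟨p', hp'⟩ : ∃ p', p = 2 * p' + 1 := (Fact.out : p.Prime).odd_of_ne_two hp
  have hone : ∀ m : ℤ, ω ^ (m * ((k - 1 : ℕ) : ℤ)) = 1 ↔ (2 * r : ℤ) ∣ m := by
    intro m
    rw [zpow_generator_eq_one_iff hω hq, Nat.cast_mul, mul_dvd_mul_iff_right hk0]
    push_cast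
    rfl
  have hlev : ∀ m : ℤ, (r : ℤ) ∣ m → (0, ω ^ m) ∈ P := fun m hm =>
    hP.zero_mem_of_mem ((zpow_generator_mem_iff hω hrq m).2 hm)
  have hinl : ∀ m : ℤ, SemidirectProduct.inl (ω ^ m) ∈ H → (r : ℤ) ∣ m → (2 * r : ℤ) ∣ m := by
    intro m hm hrm
    have h2 := hP.pow_eq_one (by omega) hA hm (hlev m hrm)
    simp only [SemidirectProduct.right_inl, SemidirectProduct.left_inl, map_one,
      MulAut.one_apply, div_mul_cancel_right, ← zpow_neg, ← zpow_natCast, ← zpow_mul] at h2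
    simpa using (hone _).1 h2
  have hfrob : ∀ m : ℤ, (⟨ω ^ m, frobAut F p⟩ : DetAut F) ∈ H → (r : ℤ) ∣ m →
      (2 * r : ℤ) ∣ (p - 1) * e - m := by
    intro m hm hrm
    have h2 := hP.pow_eq_one (by omega) hA hm (hlev m hrm)
    simp only [unitsAutHom_frobAut, ← zpow_add, ← zpow_natCast, ← zpow_mul,
        div_eq_mul_inv, ← zpow_neg] at h2
    have := (hone _).1 h2
    convert this using 1
    ring
  have hmul : ∀ m n : ℤ, SemidirectProduct.inl (ω ^ m) ∈ H → SemidirectProduct.inl (ω ^ n) ∈ H →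
      SemidirectProduct.inl (ω ^ (m + n)) ∈ H := by
    intro m n hm hn
    rw [zpow_add, map_mul]
    exact mul_mem hm hn
  have hzmul : ∀ m n : ℤ, SemidirectProduct.inl (ω ^ m) ∈ H →
      SemidirectProduct.inl (ω ^ (m * n)) ∈ H := by
    intro m n hm
    rw [zpow_mul, map_zpow]
    exact Subgroup.zpow_mem _ hm n
  have hsq : SemidirectProduct.inl (ω ^ (2 * r : ℤ)) ∈ H := by
    have := hH.sq_mem
    rwa [← pow_mul, ← zpow_natCast, Nat.cast_mul, mul_comm] at this
  -- Some `ω ^ m` with `m ≡ 1` modulo `r` is available; its square differs from `ω ^ 2` by a power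
  -- of the scalar determinant `ω^(2r)`.
  have htwo : SemidirectProduct.inl (ω ^ (2 : ℤ)) ∈ H := by
    obtain ⟨d, hd, hωd⟩ := hH.exists_inl hω hr hr3 hrq ω
    obtain ⟨m, rfl⟩ := Subgroup.mem_zpowers_iff.1 (hω d)
    have h3 := zpow_div_zpow_mem_iff hω hrq 1 m
    rw [zpow_one] at h3
    obtain ⟨i, hi⟩ := h3.1 hωd
    have h4 := hmul _ _ (hzmul m 2 hd) (hzmul _ i hsq)
    convert h4 using 3
    linear_combination 2 * hi
  -- An odd exponent could be shifted by even ones to `r`, which is odd; but `hinl` excludes `ω ^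
  -- r`.
  have heven : ∀ m : ℤ, SemidirectProduct.inl (ω ^ m) ∈ H → (2 : ℤ) ∣ m := by
    intro m hm
    by_contra hodd
    have h4 := hmul _ _ hm (hzmul 2 ((r - m) / 2) htwo)
    have h5 : m + 2 * ((r - m) / 2) = r := by omega
    rw [h5] at h4
    have h6 := hinl _ h4 dvd_rfl
    have := (dvd_mul_right (2 : ℤ) r).trans h6
    omega
  -- Since `r = a + 1`, Frobenius occurs with some determinant, which even shifts reduce to `1` or
  -- `ω ^ r`. The latter contradicts `hfrob`, because `(p - 1) e` is even and `r` is odd.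
  have hfr : SemidirectProduct.inr (frobAut F p) ∈ H := by
    obtain ⟨s, hs, hsr⟩ := (hH.le_add_one hω hrq p ha).2 hra (frobAut F p)
    obtain ⟨m, hm⟩ := Subgroup.mem_zpowers_iff.1 (hω s.left)
    have hshift : ∀ n : ℤ, (⟨ω ^ (2 * n + m), frobAut F p⟩ : DetAut F) ∈ H := by
      intro n
      have h4 := mul_mem (hzmul 2 n htwo) hs
      rwa [inl_mul_eq, hsr, ← hm, ← zpow_add] at h4
    rcases Int.even_or_odd' m with ⟨m', hm' | hm'⟩
    · have h4 := hshift (-m')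
      rw [show 2 * -m' + m = 0 by omega, zpow_zero] at h4
      exact h4
    · have h4 := hshift (r' - m')
      rw [show 2 * (r' - m') + m = r by omega] at h4
      have h5 := (dvd_mul_right (2 : ℤ) r).trans (hfrob _ h4 dvd_rfl)
      have h6 : ((p : ℤ) - 1) * e = 2 * (p' * e) := by rw [hp']; push_cast; ring
      rw [h6] at h5
      omega
  refine ⟨le_antisymm ?_ (sup_le ?_ ?_), ?_⟩
  · intro s hs
    obtain ⟨j, -, hj⟩ := exists_frobAut_pow p ha s.right
    obtain ⟨m, hm⟩ := Subgroup.mem_zpowers_iff.1 (hω s.left)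
    have hs' : s = SemidirectProduct.inl (ω ^ m) * SemidirectProduct.inr (frobAut F p) ^ j := by
      rw [← map_pow, ← hj, hm, SemidirectProduct.inl_left_mul_inr_right]
    have h4 : SemidirectProduct.inl (ω ^ m) ∈ H := by
      rw [hs'] at hs
      exact (Subgroup.mul_mem_cancel_right _ (pow_mem hfr j)).1 hs
    obtain ⟨n, rfl⟩ := heven m h4
    rw [hs']
    refine Subgroup.mul_mem_sup ⟨n, ?_⟩ (pow_mem (Subgroup.mem_zpowers _) j)
    simp only
    rw [← map_zpow, pow_one, zpow_mul]
    rfl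
  · rw [Subgroup.zpowers_le, pow_one]
    exact htwo
  · rw [Subgroup.zpowers_le]
    exact hfr
  · have := hfrob 0 (by rw [zpow_zero]; exact hfr) (dvd_zero _)
    rwa [sub_zero] at this

/-- The exceptional groups for the field with nine elements. -/
theorem IsBaseBlock.eq_twisted_sup (hP : IsBaseBlock ω 2 H P) (hH : IsRankThreeDetAut ω 2 H)
    (hω : ∀ x : Fˣ, x ∈ Subgroup.zpowers ω) [Fact (Nat.Prime 3)] [CharP F 3]
    (hq : Nat.card F = 9) {e : ℤ}
    (hA : (hP.fiber : Set F) = mulSubfield ((ω ^ e : Fˣ) : F) 3) :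
    H = Subgroup.zpowers (SemidirectProduct.inl ((ω ^ 2) ^ 2)) ⊔
        Subgroup.zpowers ⟨ω, frobAut F 3⟩ ∨
      H = Subgroup.zpowers (SemidirectProduct.inl ((ω ^ 2) ^ 2)) ⊔
        Subgroup.zpowers ⟨ω ^ 3, frobAut F 3⟩ := by
  have hrq : 2 ∣ Nat.card F - 1 := by rw [hq]; norm_num
  have hinl2 : ∀ m : ℤ, SemidirectProduct.inl (ω ^ m) ∈ H → (2 : ℤ) ∣ m → (4 : ℤ) ∣ m := by
    intro m hm hrm
    have h2 := hP.pow_eq_one (by omega) hA hm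
      (hP.zero_mem_of_mem ((zpow_generator_mem_iff hω hrq m).2 hrm))
    simp only [SemidirectProduct.right_inl, SemidirectProduct.left_inl, map_one,
      MulAut.one_apply, div_mul_cancel_right, ← zpow_neg, ← zpow_natCast, ← zpow_mul] at h2
    rw [zpow_generator_eq_one_iff hω hq] at h2
    push_cast at h2
    omega
  -- For odd `m` the square of the element would violate `hinl2`. Hence the pure determinants in `H`
  -- are just the powers of `ω ^ 4`.
  have hinl : ∀ m : ℤ, SemidirectProduct.inl (ω ^ m) ∈ H → (4 : ℤ) ∣ m := by
    intro m hm
    refine hinl2 m hm ?_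
    have h4 : SemidirectProduct.inl (ω ^ (m * 2)) ∈ H := by
      rw [zpow_mul, map_zpow]
      exact Subgroup.zpow_mem _ hm 2
    have := hinl2 _ h4 (Dvd.intro_left _ rfl)
    omega
  have hfour : SemidirectProduct.inl (ω ^ (4 : ℤ)) ∈ H := by
    have := hH.sq_mem
    rwa [← pow_mul] at this
  have hzfour : ∀ n : ℤ, SemidirectProduct.inl (ω ^ (4 * n)) ∈ H := by
    intro n
    rw [zpow_mul, map_zpow]
    exact Subgroup.zpow_mem _ hfour n
  have hright : ∀ s : DetAut F, s.right = 1 ∨ s.right = frobAut F 3 := by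
    intro s
    obtain ⟨j, hj, hjs⟩ := exists_frobAut_pow 3 (a := 2) (by rw [hq]; norm_num) s.right
    interval_cases j
    · exact Or.inl hjs
    · exact Or.inr (by rwa [pow_one] at hjs)
  have hgen : ∀ d : Fˣ, (⟨d, frobAut F 3⟩ : DetAut F) ∈ H →
      H = Subgroup.zpowers (SemidirectProduct.inl ((ω ^ 2) ^ 2)) ⊔
        Subgroup.zpowers ⟨d, frobAut F 3⟩ := by
    intro d hd
    have hker : ∀ s ∈ H, s.right = 1 →
        s ∈ Subgroup.zpowers (SemidirectProduct.inl ((ω ^ 2) ^ 2) : DetAut F) := by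
      intro s hs hs1
      obtain ⟨m, hm⟩ := Subgroup.mem_zpowers_iff.1 (hω s.left)
      have hs' : s = SemidirectProduct.inl (ω ^ m) := SemidirectProduct.ext hm.symm hs1
      rw [hs'] at hs ⊢
      obtain ⟨n, rfl⟩ := hinl m hs
      refine ⟨n, ?_⟩
      simp only
      rw [← map_zpow, ← pow_mul, zpow_mul]
      rfl
    refine le_antisymm ?_ (sup_le ?_ ?_)
    · intro s hs
      rcases hright s with h | h
      · exact le_sup_left (a := Subgroup.zpowers (SemidirectProduct.inl ((ω ^ 2) ^ 2))) (hker s hs h)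
      · have h1 : (s * (⟨d, frobAut F 3⟩ : DetAut F)⁻¹).right = 1 := by
          rw [SemidirectProduct.mul_right, SemidirectProduct.inv_right, h, mul_inv_cancel]
        have h2 := hker _ (mul_mem hs (inv_mem hd)) h1
        have h3 := Subgroup.mul_mem_sup h2
          (Subgroup.mem_zpowers (⟨d, frobAut F 3⟩ : DetAut F))
        rwa [inv_mul_cancel_right] at h3
    · rw [Subgroup.zpowers_le]; exact hH.sq_mem
    · rw [Subgroup.zpowers_le]; exact hd
  obtain ⟨s, hs, hωs⟩ := hH.transitive ω
  obtain ⟨m, hm⟩ := Subgroup.mem_zpowers_iff.1 (hω s.left)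
  have h3 := zpow_div_zpow_mem_iff hω hrq 1 m
  rw [zpow_one] at h3
  rw [← hm, h3] at hωs
  push_cast at hωs
  rcases hright s with h | h
  · have hs' : s = SemidirectProduct.inl (ω ^ m) := SemidirectProduct.ext hm.symm h
    rw [hs'] at hs
    have := hinl m hs
    omega
  · have hshift : ∀ n : ℤ, (⟨ω ^ (4 * n + m), frobAut F 3⟩ : DetAut F) ∈ H := by
      intro n
      have h4 := mul_mem (hzfour n) hs
      rwa [inl_mul_eq, h, ← hm, ← zpow_add] at h4
    -- The exponent `m` is odd and matters only modulo `4`; its residues `1` and `3` give the two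
    -- groups.
    have h4 := hshift (-(m / 4))
    rcases (by omega : 4 * -(m / 4) + m = 1 ∨ 4 * -(m / 4) + m = 3) with h5 | h5
    · rw [h5, zpow_one] at h4
      exact Or.inl (hgen _ h4)
    · rw [h5] at h4
      exact Or.inr (hgen _ h4)

end Classification

/-! ### Blocks with trivial fibre -/

section TrivialFiber

set_option linter.unusedSectionVars false

variable {F : Type*} [Field F] [Finite F] {ω : Fˣ} {r : ℕ} {H : Subgroup (DetAut F)}
  {P : Set (F × Fˣ)}

/-- Blocks with trivial fibre. -/
theorem IsBaseBlock.of_fiber_eq_bot (hP : IsBaseBlock ω r H P) (hH : IsRankThreeDetAut ω r H)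
    (hω : ∀ x : Fˣ, x ∈ Subgroup.zpowers ω) (hr : r.Prime) (hrq : r ∣ Nat.card F - 1)
    (p : ℕ) [Fact p.Prime] [CharP F p] (hq : Nat.card F ≠ 3)
    (hbot : hP.fiber = ⊥) (hex : ∀ u, ∃ x, (x, u) ∈ P) :
    P = {z | z.1 = 0} ∨ (Nat.card F = 4 ∧ r = 3 ∧ H = ⊤ ∧ P = {z | z.1 = 1 + (z.2 : F)⁻¹}) := by
  have hL : (ω ^ r) ^ 2 ∈ Subgroup.zpowers (ω ^ r) := pow_mem (Subgroup.mem_zpowers _) 2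
  by_cases hκ : (ω ^ r) ^ 2 = 1
  swap
  · exact Or.inl (hP.eq_axis hbot hex hH.sq_mem hL hκ)
  have _ : Fintype F := Fintype.ofFinite F
  obtain ⟨a, -, ha⟩ := FiniteField.card F p
  rw [← Nat.card_eq_fintype_card] at ha
  have hdvd : p ^ (a : ℕ) - 1 ∣ 2 * r := by
    rw [← pow_mul] at hκ
    have := orderOf_dvd_of_pow_eq_one hκ
    rwa [orderOf_generator hω, ha, mul_comm] at this
  have hra := (hH.le_add_one hω hrq p ha).1
  rcases arith_two_mul Fact.out a.pos (ha ▸ hq) hr hra (ha ▸ hrq) hdvd with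
    ⟨rfl, h2, rfl⟩ | ⟨rfl, h1, rfl⟩
  · rw [h2] at ha
    have hq4 : Nat.card F = 3 + 1 := ha
    have hω3 : ω ^ 3 = 1 := by
      have := (zpow_generator_eq_one_iff hω hq4 3).2 dvd_rfl
      exact_mod_cast this
    have htop : H = ⊤ := hH.eq_top hω hr le_rfl hrq 2 ha rfl (j := 0) (by rw [hω3, pow_zero])
    subst htop
    have hcases : ∀ u : Fˣ, u = 1 ∨ u = ω ∨ u = ω ^ 2 := by
      intro u
      obtain ⟨n, rfl⟩ := exists_pow_eq hω u
      have h1 : ω ^ n = ω ^ (n % 3) := by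
        conv_lhs => rw [← Nat.div_add_mod n 3, pow_add, pow_mul, hω3, one_pow, one_mul]
      rw [h1]
      have : n % 3 < 3 := Nat.mod_lt _ (by norm_num)
      interval_cases n % 3 <;> simp
    have huniq : ∀ x y u, (x, u) ∈ P → (y, u) ∈ P → x = y := by
      intro x y u hx hy
      have h4 : y - x ∈ hP.fiber := hP.sub_fst_mem hx hy
      rw [hbot, AddSubgroup.mem_bot] at h4
      exact (sub_eq_zero.1 h4).symm
    -- The block is the graph of a function of `u`, determined by its value `g` at `ω`. Reaching
    -- level `ω ^ 2` by the determinant `ω` and by Frobenius gives `g / ω + g = g ^ 2`, so `g = 0`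
    -- or `g = 1 + ω⁻¹`.
    obtain ⟨g, hg⟩ := hex ω
    have h1 : (g / ω + g, ω ^ 2) ∈ P := by
      have := hP.affAct_mem (s := SemidirectProduct.inl ω) (Subgroup.mem_top _) hg _ hg
      simpa [affAct, ← pow_two] using this
    have h2 : (g ^ 2, ω ^ 2) ∈ P := by
      have := hP.affAct_mem (s := SemidirectProduct.inr (frobAut F 2)) (Subgroup.mem_top _)
        (y := 0) (by simpa using hP.zero_mem) _ hg
      simpa [affAct, frobAut_apply, unitsAutHom_frobAut] using this
    have hg2 := huniq _ _ _ h1 h2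
    have hset : ∀ h : Fˣ → F, h 1 = 0 → h ω = g → h (ω ^ 2) = g ^ 2 → P = {z | z.1 = h z.2} := by
      intro h hh1 hhω hhω2
      have hmem : ∀ u, (h u, u) ∈ P := by
        intro u
        rcases hcases u with rfl | rfl | rfl
        · rw [hh1]; exact hP.zero_mem
        · rw [hhω]; exact hg
        · rw [hhω2]; exact h2
      ext ⟨x, u⟩
      refine ⟨fun hx => huniq _ _ _ hx (hmem u), fun hx => ?_⟩
      have hx : x = h u := hx
      rw [hx]
      exact hmem u
    have hω0 : (ω : F) ≠ 0 := ω.ne_zero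
    have htwo : (2 : F) = 0 := by exact_mod_cast CharP.cast_eq_zero F 2
    by_cases hg0 : g = 0
    · exact Or.inl (hset (fun _ => 0) rfl hg0.symm (by simp [hg0]))
    · have hgω : g = 1 + (ω : F)⁻¹ := by
        apply mul_left_cancel₀ hg0
        rw [← pow_two, ← hg2]
        ring
      refine Or.inr ⟨hq4, rfl, rfl, hset (fun u => 1 + (u : F)⁻¹) ?_ hgω.symm ?_⟩
      · simp only [Units.val_one, inv_one]
        linear_combination htwo
      · rw [hgω, Units.val_pow_eq_pow_val]
        field_simp
        linear_combination -(ω : F) * htwo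
  · rw [h1] at ha
    have hq5 : Nat.card F = 4 + 1 := ha
    obtain ⟨s, hs, hωs⟩ := hH.transitive ω
    obtain ⟨m, hm⟩ := Subgroup.mem_zpowers_iff.1 (hω s.left)
    have h3 := zpow_div_zpow_mem_iff hω hrq 1 m
    rw [zpow_one] at h3
    rw [← hm, h3] at hωs
    obtain ⟨j, hj, hjs⟩ := exists_frobAut_pow 5 (a := 1) ha s.right
    have hs1 : s.right = 1 := by
      rw [hjs, Nat.lt_one_iff.1 hj, pow_zero]
    have hs' : s = SemidirectProduct.inl (ω ^ m) := SemidirectProduct.ext hm.symm hs1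
    rw [hs'] at hs
    -- For `q = 5` the scalar determinant is trivial, but the square of an element at the nontrivial
    -- level has determinant `ω ^ (2 m)` with `m` odd: it lies in `⟨ω²⟩` and differs from `1`.
    have hs2 : SemidirectProduct.inl (ω ^ (m * 2)) ∈ H := by
      rw [zpow_mul, map_zpow]
      exact Subgroup.zpow_mem _ hs 2
    refine Or.inl (hP.eq_axis hbot hex hs2 ?_ ?_)
    · rw [zpow_generator_mem_iff hω hrq]
      push_cast
      omega
    · rw [Ne, zpow_generator_eq_one_iff hω hq5]
      push_cast at *
      omega

end TrivialFiber

/-! ### The classification -/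

section MainClassification

set_option linter.unusedSectionVars false

variable {F : Type*} [Field F] [Finite F] {ω : Fˣ} {r : ℕ} {H : Subgroup (DetAut F)}
  {P : Set (F × Fˣ)}

/-- The hypothesis says that `ω ^ (e - f)` lies in `𝔽_k`, so the two generators span the same coset.
It is used to normalise exponents. -/
theorem mulSubfield_zpow_mul (hω : ∀ x : Fˣ, x ∈ Subgroup.zpowers ω) {n k : ℕ}
    (hn : Nat.card F = n + 1) (hk : 0 < k) {e f : ℤ} (h : (n : ℤ) ∣ (e - f) * (k - 1 : ℕ)) :
    mulSubfield ((ω ^ e : Fˣ) : F) k = mulSubfield ((ω ^ f : Fˣ) : F) k := by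
  have h1 : ((ω ^ (e - f)) ^ (k - 1) : Fˣ) = 1 := by
    rw [← zpow_natCast, ← zpow_mul, zpow_generator_eq_one_iff hω hn]
    exact h
  have h2 : ((ω ^ e : Fˣ) : F) = ((ω ^ f : Fˣ) : F) * ((ω ^ (e - f) : Fˣ) : F) := by
    rw [← Units.val_mul, ← zpow_add]
    congr 2
    ring
  rw [h2]
  refine mulSubfield_mul _ _ ?_ (Units.ne_zero _)
  rw [← Units.val_pow_eq_pow_val]
  congr 1
  conv_lhs => rw [← Nat.sub_add_cancel hk, pow_succ, h1, one_mul]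

/-- The table of additional blocks in coordinates. -/
def IsAdditionalAffBlock (p : ℕ) [Fact p.Prime] [CharP F p] (ω : Fˣ) (r : ℕ)
    (H : Subgroup (DetAut F)) (A : Set F) (k : ℕ) : Prop :=
  (p = 2 ∧ Nat.card F = 4 ∧ r = 3 ∧ k = 2 ∧ H = ⊤ ∧ A = mulSubfield 1 2) ∨
  (p = 2 ∧ Nat.card F = 16 ∧ r = 5 ∧ k = 4 ∧ H = ⊤ ∧ A = mulSubfield 1 4) ∨
  (p = 3 ∧ Nat.card F = 81 ∧ r = 5 ∧ k = 9 ∧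
    H = Subgroup.zpowers (SemidirectProduct.inl ((ω ^ 1) ^ 2)) ⊔
        Subgroup.zpowers (SemidirectProduct.inr (frobAut F p)) ∧
    (A = mulSubfield 1 9 ∨ A = mulSubfield ((ω : F) ^ 5) 9)) ∨
  (p = 5 ∧ Nat.card F = 25 ∧ r = 3 ∧ k = 5 ∧
    H = Subgroup.zpowers (SemidirectProduct.inl ((ω ^ 1) ^ 2)) ⊔
        Subgroup.zpowers (SemidirectProduct.inr (frobAut F p)) ∧
    (A = mulSubfield 1 5 ∨ A = mulSubfield ((ω : F) ^ 3) 5)) ∨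
  (p = 3 ∧ Nat.card F = 9 ∧ r = 2 ∧ k = 3 ∧
    (H = Subgroup.zpowers (SemidirectProduct.inl ((ω ^ 2) ^ 2)) ⊔
        Subgroup.zpowers ⟨ω, frobAut F p⟩ ∨
      H = Subgroup.zpowers (SemidirectProduct.inl ((ω ^ 2) ^ 2)) ⊔
        Subgroup.zpowers ⟨ω ^ 3, frobAut F p⟩) ∧
    ∃ i ≤ 3, A = mulSubfield ((ω : F) ^ i) 3)

/-- In characteristic two Frobenius gives `τ c / c = c`, so `c` itself lies in `𝔽_k`. -/
theorem IsBaseBlock.pow_eq_one_of_eq_top (hP : IsBaseBlock ω r ⊤ P) [Fact (Nat.Prime 2)]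
    [CharP F 2] {c : Fˣ} {k : ℕ} (hk : 0 < k)
    (hA : (hP.fiber : Set F) = mulSubfield (c : F) k) : c ^ (k - 1) = 1 := by
  have h := hP.pow_eq_one (s := SemidirectProduct.inr (frobAut F 2)) hk hA
    (Subgroup.mem_top _) hP.zero_mem
  rwa [SemidirectProduct.right_inr, SemidirectProduct.left_inr, unitsAutHom_frobAut, one_mul,
    pow_two, mul_div_cancel_right] at h

theorem IsBaseBlock.isAdditionalAffBlock (hP : IsBaseBlock ω r H P)
    (hH : IsRankThreeDetAut ω r H)
    (hω : ∀ x : Fˣ, x ∈ Subgroup.zpowers ω) (hr : r.Prime) (hrq : r ∣ Nat.card F - 1)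
    (h0 : hP.fiber ≠ ⊥) (h1 : hP.fiber ≠ ⊤) (p : ℕ) [Fact p.Prime] [CharP F p] :
    ∃ k, IsAdditionalAffBlock p ω r H hP.fiber k ∧ (hP.fiber : Set F).ncard = k := by
  obtain ⟨k, c, hA, hcard, hcases⟩ := hP.exists_fiber_eq hH hω hr hrq h0 h1 p
  refine ⟨k, ?_, hcard⟩
  obtain ⟨e, rfl⟩ := Subgroup.mem_zpowers_iff.1 (hω c)
  have hone : ∀ i : ℕ, (((ω ^ (i : ℤ) : Fˣ)) : F) = (ω : F) ^ i := fun i => by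
    rw [zpow_natCast, Units.val_pow_eq_pow_val]
  have hone0 : (((ω ^ (0 : ℤ) : Fˣ)) : F) = 1 := by rw [zpow_zero, Units.val_one]
  rcases hcases with ⟨rfl, hq, rfl, rfl⟩ | ⟨rfl, hq, rfl, rfl⟩ | ⟨rfl, hq, rfl, rfl⟩ |
      ⟨rfl, hq, rfl, rfl⟩ | ⟨rfl, hq, rfl, rfl⟩
  · have hω3 : ω ^ 3 = 1 := by
      exact_mod_cast (zpow_generator_eq_one_iff hω hq 3).2 dvd_rfl
    obtain rfl : H = ⊤ := hH.eq_top hω hr le_rfl hrq 2 (a := 2) (by rw [hq]; norm_num) rfl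
      (j := 0) (by rw [hω3, pow_zero])
    refine Or.inl ⟨rfl, hq, rfl, rfl, rfl, ?_⟩
    have he := hP.pow_eq_one_of_eq_top (by norm_num) hA
    rw [pow_one] at he
    rw [hA, he, Units.val_one]
  · have hω15 : ω ^ 15 = 1 := by
      exact_mod_cast (zpow_generator_eq_one_iff hω hq 15).2 dvd_rfl
    obtain rfl : H = ⊤ := hH.eq_top hω hr (by norm_num) hrq 2 (a := 4) (by rw [hq]; norm_num) rfl
      (j := 2) (by
        rw [← pow_mul, ← pow_mul, show 5 * 2 * 2 = 15 + 5 by norm_num, pow_add, hω15, one_mul])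
    refine Or.inr (Or.inl ⟨rfl, hq, rfl, rfl, rfl, ?_⟩)
    have he := hP.pow_eq_one_of_eq_top (by norm_num) hA
    rw [← zpow_natCast, ← zpow_mul, zpow_generator_eq_one_iff hω hq] at he
    rw [hA, ← hone0]
    exact mulSubfield_zpow_mul hω hq (by norm_num) (by simpa using he)
  · obtain ⟨hH', he⟩ := hP.eq_squares_sup hH hω hr (by norm_num) 3 (by norm_num) (a := 4)
      (by rw [hq]; norm_num) rfl (by norm_num) (by rw [hq]) hA
    refine Or.inr (Or.inr (Or.inl ⟨rfl, hq, rfl, rfl, hH', ?_⟩))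
    rw [hA]
    push_cast at he
    -- The coset depends on `e` modulo `80 / 8 = 10`, and `10 ∣ 2 e`.
    rcases (by omega : e % 10 = 0 ∨ e % 10 = 5) with h | h
    · left
      rw [← hone0]
      exact mulSubfield_zpow_mul hω hq (by norm_num) (by push_cast; omega)
    · right
      rw [← hone]
      exact mulSubfield_zpow_mul hω hq (by norm_num) (by push_cast; omega)
  · obtain ⟨hH', he⟩ := hP.eq_squares_sup hH hω hr (by norm_num) 5 (by norm_num) (a := 2)
      (by rw [hq]; norm_num) rfl (by norm_num) (by rw [hq]) hA
    refine Or.inr (Or.inr (Or.inr (Or.inl ⟨rfl, hq, rfl, rfl, hH', ?_⟩)))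
    rw [hA]
    push_cast at he
    rcases (by omega : e % 6 = 0 ∨ e % 6 = 3) with h | h
    · left
      rw [← hone0]
      exact mulSubfield_zpow_mul hω hq (by norm_num) (by push_cast; omega)
    · right
      rw [← hone]
      exact mulSubfield_zpow_mul hω hq (by norm_num) (by push_cast; omega)
  · have hH' := hP.eq_twisted_sup hH hω hq hA
    refine Or.inr (Or.inr (Or.inr (Or.inr ⟨rfl, hq, rfl, rfl, hH', ?_⟩)))
    rw [hA]
    -- The coset depends on `e` modulo `8 / 2 = 4`, and all four classes occur.
    refine ⟨(e % 4).toNat, by omega, ?_⟩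
    rw [← hone]
    exact mulSubfield_zpow_mul hω hq (by norm_num) (by push_cast; omega)

/-- The nontrivial blocks of the affine action that contain the base point. -/
theorem IsBaseBlock.classification (hP : IsBaseBlock ω r H P) (hH : IsRankThreeDetAut ω r H)
    (hω : ∀ x : Fˣ, x ∈ Subgroup.zpowers ω) (hr : r.Prime) (hrq : r ∣ Nat.card F - 1)
    (p : ℕ) [Fact p.Prime] [CharP F p] (hq : Nat.card F ≠ 3)
    (hnt : ∃ z ∈ P, ¬(z.1 = 0 ∧ z.2 ∈ Subgroup.zpowers (ω ^ r))) (huniv : P ≠ Set.univ) :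
    P = {z | z.1 = 0} ∨ P = {z | z.1 ∈ Set.univ ∧ z.2 ∈ Subgroup.zpowers (ω ^ r)} ∨
      (Nat.card F = 4 ∧ r = 3 ∧ H = ⊤ ∧ P = {z | z.1 = 1 + (z.2 : F)⁻¹}) ∨
      ∃ k A, IsAdditionalAffBlock p ω r H A k ∧ A.ncard = k ∧
        P = {z | z.1 ∈ A ∧ z.2 ∈ Subgroup.zpowers (ω ^ r)} := by
  by_cases hlev : ∀ x u, (x, u) ∈ P → u ∈ Subgroup.zpowers (ω ^ r)
  · have hline := hP.eq_lineSet hlev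
    have h0 : hP.fiber ≠ ⊥ := by
      intro h0
      obtain ⟨z, hz, hz'⟩ := hnt
      rw [hline, h0] at hz
      exact hz' hz
    by_cases h1 : hP.fiber = ⊤
    · rw [h1] at hline
      exact Or.inr (Or.inl hline)
    · obtain ⟨k, hk, hcard⟩ := hP.isAdditionalAffBlock hH hω hr hrq h0 h1 p
      exact Or.inr (Or.inr (Or.inr ⟨k, _, hk, hcard, hline⟩))
  · have hlev' := hlev
    push Not at hlev
    obtain ⟨y, v, hyv, hv⟩ := hlev
    have hex := hP.exists_mem hH hω hr hrq hv hyv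
    by_cases h0 : hP.fiber = ⊥
    · rcases hP.of_fiber_eq_bot hH hω hr hrq p hq h0 hex with h | h
      · exact Or.inl h
      · exact Or.inr (Or.inr (Or.inl h))
    · by_cases h1 : hP.fiber = ⊤
      · exact absurd (hP.eq_univ h1 hex) huniv
      · exact absurd (hP.mem_zpowers_of_fiber hH hω hr hrq h0 h1 p) hlev'

end MainClassification

/-! ### The blocks in the list are blocks -/

section Converse

set_option linter.unusedSectionVars false

variable {F : Type*} [Field F] [Finite F] {ω : Fˣ} {r : ℕ} {H : Subgroup (DetAut F)}

theorem isAffBlock_axis (H : Subgroup (DetAut F)) : IsAffBlock H {z | z.1 = 0} := by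
  rintro s - t ⟨⟨x, u⟩, hx, h⟩ ⟨y, w⟩ hy
  simp only [Set.mem_ofPred_eq, affAct] at *
  subst hx hy
  simpa using h

/-- For a point on the graph, the image misses the graph by `1 / d + t - 1`, which does not depend
on the point. One image on the graph therefore puts all of them there. -/
theorem isAffBlock_one_add_inv (H : Subgroup (DetAut F)) :
    IsAffBlock H {z | z.1 = 1 + (z.2 : F)⁻¹} := by
  rintro s - t ⟨⟨x, u⟩, hx, h⟩ ⟨y, w⟩ hy
  simp only [Set.mem_ofPred_eq, affAct] at *
  subst hx hy
  simp only [map_add, map_one, map_inv₀, Units.val_mul, coe_unitsAutHom, mul_inv] at h ⊢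
  linear_combination h

/-- Automorphisms preserve `⟨ωʳ⟩`, so a translate can meet the line only if `d ∈ ⟨ωʳ⟩`. Invariance
of `A` then forces `t ∈ A`. -/
theorem isAffBlock_lineSet (A : Set F) (hadd : ∀ x ∈ A, ∀ y ∈ A, x + y ∈ A)
    (hsub : ∀ x ∈ A, ∀ y ∈ A, x - y ∈ A)
    (hA : ∀ s ∈ H, s.left ∈ Subgroup.zpowers (ω ^ r) → ∀ x ∈ A, s.right x / s.left ∈ A) :
    IsAffBlock H {z | z.1 ∈ A ∧ z.2 ∈ Subgroup.zpowers (ω ^ r)} := by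
  rintro s hs t ⟨⟨x, u⟩, ⟨hx, hu⟩, h1, h2⟩ ⟨y, w⟩ ⟨hy, hw⟩
  simp only [affAct] at *
  have hL : ∀ u ∈ Subgroup.zpowers (ω ^ r),
      unitsAutHom F s.right u ∈ Subgroup.zpowers (ω ^ r) := fun u hu =>
    mem_zpowers_of_ringEquiv s.right _ u hu
  have hd : s.left ∈ Subgroup.zpowers (ω ^ r) :=
    (Subgroup.mul_mem_cancel_right _ (hL u hu)).1 h2
  have ht : t ∈ A := by
    have := hsub _ h1 _ (hA s hs hd x hx)
    rwa [add_sub_cancel_left] at this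
  exact ⟨hadd _ (hA s hs hd y hy) _ ht, mul_mem hd (hL w hw)⟩

theorem div_mem_mulSubfield {c : Fˣ} {k : ℕ} (hk : 0 < k) {s : DetAut F}
    (h : (unitsAutHom F s.right c / (s.left * c)) ^ (k - 1) = 1) :
    ∀ x ∈ mulSubfield (c : F) k, s.right x / s.left ∈ mulSubfield (c : F) k := by
  rintro _ ⟨y, hy, rfl⟩
  refine ⟨((unitsAutHom F s.right c / (s.left * c) : Fˣ) : F) * s.right y, ?_, ?_⟩
  · have h1 : (unitsAutHom F s.right c / (s.left * c)) ^ k =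
        unitsAutHom F s.right c / (s.left * c) := by
      conv_lhs => rw [← Nat.sub_add_cancel hk, pow_succ, h, one_mul]
    rw [mul_pow, ← map_pow, hy, ← Units.val_pow_eq_pow_val, h1]
  · have hc0 : (c : F) ≠ 0 := c.ne_zero
    have hl0 : (s.left : F) ≠ 0 := s.left.ne_zero
    rw [Units.val_div_eq_div_val, coe_unitsAutHom, Units.val_mul, map_mul]
    field_simp

theorem add_mem_mulSubfield (p : ℕ) [Fact p.Prime] [CharP F p] (c : F) (b : ℕ) :
    (∀ x ∈ mulSubfield c (p ^ b), ∀ y ∈ mulSubfield c (p ^ b), x + y ∈ mulSubfield c (p ^ b)) ∧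
      ∀ x ∈ mulSubfield c (p ^ b), ∀ y ∈ mulSubfield c (p ^ b),
        x - y ∈ mulSubfield c (p ^ b) := by
  constructor
  · rintro _ ⟨x, hx, rfl⟩ _ ⟨y, hy, rfl⟩
    exact ⟨x + y, by rw [add_pow_char_pow, hx, hy], by ring⟩
  · rintro _ ⟨x, hx, rfl⟩ _ ⟨y, hy, rfl⟩
    exact ⟨x - y, by rw [sub_pow_char_pow, hx, hy], by ring⟩

theorem unitsAutHom_eq_self_of_sq (τ : RingAut F) {y : Fˣ} (hy : y ^ 2 = 1) :
    unitsAutHom F τ y = y := by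
  have h : (y : F) * y = 1 := by
    rw [← pow_two, ← Units.val_pow_eq_pow_val, hy, Units.val_one]
  ext
  rw [coe_unitsAutHom]
  rcases mul_self_eq_one_iff.1 h with h | h <;> simp [h]

variable (F) in
/-- The pairs whose determinant is a square. -/
def squareDet : Subgroup (DetAut F) where
  carrier := {s | IsSquare s.left}
  mul_mem' := fun {s _} hs ht => IsSquare.mul hs (IsSquare.map (unitsAutHom F s.right) ht)
  one_mem' := IsSquare.one
  inv_mem' := fun {s} hs => IsSquare.map (unitsAutHom F s.right⁻¹) (IsSquare.inv hs)

theorem squares_sup_le (p : ℕ) [Fact p.Prime] [CharP F p] :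
    Subgroup.zpowers (SemidirectProduct.inl ((ω ^ 1) ^ 2)) ⊔
        Subgroup.zpowers (SemidirectProduct.inr (frobAut F p)) ≤ squareDet F := by
  refine sup_le ?_ ?_
  · rw [Subgroup.zpowers_le]
    exact ⟨ω, by rw [SemidirectProduct.left_inl, pow_one, pow_two]⟩
  · rw [Subgroup.zpowers_le]
    exact IsSquare.one

/-- The group of order four of pairs that occurs for the field with nine elements. -/
def twistedGroup (φ : RingAut F) (hφ : φ * φ = 1) (hφ' : ∀ x, unitsAutHom F φ x = x ^ 3)
    (w : Fˣ) (hw : w ^ 8 = 1) : Subgroup (DetAut F) where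
  carrier := {s | (s.right = 1 ∧ s.left ^ 2 = 1) ∨ (s.right = φ ∧ s.left ^ 2 = w ^ 2)}
  one_mem' := Or.inl ⟨rfl, one_pow 2⟩
  mul_mem' := by
    rintro s t (⟨hs, hs'⟩ | ⟨hs, hs'⟩) (⟨ht, ht'⟩ | ⟨ht, ht'⟩)
    · refine Or.inl ⟨?_, ?_⟩
      · rw [SemidirectProduct.mul_right, hs, ht, one_mul]
      · rw [SemidirectProduct.mul_left, hs, map_one, MulAut.one_apply, mul_pow, hs', ht', one_mul]
    · refine Or.inr ⟨?_, ?_⟩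
      · rw [SemidirectProduct.mul_right, hs, ht, one_mul]
      · rw [SemidirectProduct.mul_left, hs, map_one, MulAut.one_apply, mul_pow, hs', ht', one_mul]
    · refine Or.inr ⟨?_, ?_⟩
      · rw [SemidirectProduct.mul_right, hs, ht, mul_one]
      · rw [SemidirectProduct.mul_left, hs, hφ', mul_pow, hs', pow_right_comm, ht', one_pow,
          mul_one]
    · refine Or.inl ⟨?_, ?_⟩
      · rw [SemidirectProduct.mul_right, hs, ht, hφ]
      · rw [SemidirectProduct.mul_left, hs, hφ', mul_pow, hs', pow_right_comm, ht', ← pow_mul,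
          ← pow_add, hw]
  inv_mem' := by
    rintro s (⟨hs, hs'⟩ | ⟨hs, hs'⟩)
    · refine Or.inl ⟨?_, ?_⟩
      · rw [SemidirectProduct.inv_right, hs, inv_one]
      · rw [SemidirectProduct.inv_left, hs, inv_one, map_one, MulAut.one_apply, inv_pow, hs',
          inv_one]
    · have hinv : φ⁻¹ = φ := inv_eq_of_mul_eq_one_right hφ
      refine Or.inr ⟨?_, ?_⟩
      · rw [SemidirectProduct.inv_right, hs, hinv]
      · rw [SemidirectProduct.inv_left, hs, hinv, hφ', pow_right_comm, inv_pow, hs', inv_pow,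
          ← pow_mul, inv_eq_iff_mul_eq_one, ← pow_add, hw]

theorem frobAut_sq_eq_one [Fact (Nat.Prime 3)] [CharP F 3] (hq : Nat.card F = 9) :
    frobAut F 3 * frobAut F 3 = 1 := by
  refine RingEquiv.ext fun x => ?_
  change (x ^ 3) ^ 3 = x
  have _ : Fintype F := Fintype.ofFinite F
  rw [← pow_mul, show 3 * 3 = Fintype.card F by rw [← Nat.card_eq_fintype_card, hq],
    FiniteField.pow_card]

theorem twisted_sup_le [Fact (Nat.Prime 3)] [CharP F 3] (hq : Nat.card F = 9) {w : Fˣ}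
    (hw : w ^ 8 = 1) (hω : ω ^ 8 = 1) :
    Subgroup.zpowers (SemidirectProduct.inl ((ω ^ 2) ^ 2)) ⊔
        Subgroup.zpowers ⟨w, frobAut F 3⟩ ≤
      twistedGroup (frobAut F 3) (frobAut_sq_eq_one hq) (unitsAutHom_frobAut 3) w hw := by
  refine sup_le ?_ ?_
  · rw [Subgroup.zpowers_le]
    exact Or.inl ⟨rfl, by
      rw [SemidirectProduct.left_inl, ← pow_mul, ← pow_mul, show 2 * 2 * 2 = 8 by norm_num, hω]⟩
  · rw [Subgroup.zpowers_le]
    exact Or.inr ⟨rfl, rfl⟩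

/-- The fibre of an additional block is invariant. -/
theorem IsAdditionalAffBlock.invariant (hω : ∀ x : Fˣ, x ∈ Subgroup.zpowers ω)
    (hrq : r ∣ Nat.card F - 1) {p : ℕ} [Fact p.Prime] [CharP F p] {A : Set F} {k : ℕ}
    (h : IsAdditionalAffBlock p ω r H A k) :
    ∃ (b : ℕ) (c : Fˣ), A = mulSubfield (c : F) (p ^ b) ∧
      ∀ s ∈ H, s.left ∈ Subgroup.zpowers (ω ^ r) → ∀ x ∈ A, s.right x / s.left ∈ A := by
  have hone : ∀ i : ℕ, (((ω ^ (i : ℤ) : Fˣ)) : F) = (ω : F) ^ i := fun i => by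
    rw [zpow_natCast, Units.val_pow_eq_pow_val]
  have hone0 : (((ω ^ (0 : ℤ) : Fˣ)) : F) = 1 := by rw [zpow_zero, Units.val_one]
  have htop : ∀ k : ℕ, 0 < k → Nat.card F = r * (k - 1) + 1 → ∀ s : DetAut F,
      s.left ∈ Subgroup.zpowers (ω ^ r) →
      ∀ x ∈ mulSubfield (1 : F) k, s.right x / s.left ∈ mulSubfield (1 : F) k := by
    intro k hk hq s hs
    have := div_mem_mulSubfield (c := 1) hk (s := s) (by
      obtain ⟨m, hm⟩ := hs
      have hm : (ω ^ r) ^ m = s.left := hm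
      rw [map_one, mul_one, ← hm, one_div, inv_pow, inv_eq_one, ← zpow_natCast ω r, ← zpow_mul,
        ← zpow_natCast, ← zpow_mul, zpow_generator_eq_one_iff hω hq]
      exact ⟨m, by push_cast; ring⟩)
    simpa using this
  -- As `r` is odd, a square in `⟨ωʳ⟩` lies in `⟨ω^(2r)⟩`, which is `𝔽_k` without zero. For `c = ω ^
  -- e` with `r ∣ e`, the power `c ^ (k - 1)` squares to `1`, so it is fixed by every automorphism
  -- and cancels.
  have hsq : ∀ (k : ℕ) (e : ℤ), 0 < k → Odd r → Nat.card F = 2 * r * (k - 1) + 1 →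
      (r : ℤ) ∣ e → ∀ s ∈ squareDet F, s.left ∈ Subgroup.zpowers (ω ^ r) →
      ∀ x ∈ mulSubfield ((ω ^ e : Fˣ) : F) k,
        s.right x / s.left ∈ mulSubfield ((ω ^ e : Fˣ) : F) k := by
    intro k e hk hr hq he s hs hsL
    refine div_mem_mulSubfield hk ?_
    obtain ⟨d, hd⟩ := hs
    obtain ⟨m, rfl⟩ := Subgroup.mem_zpowers_iff.1 (hω d)
    have hd : s.left = ω ^ (m + m) := by rw [hd, zpow_add]
    rw [hd, zpow_generator_mem_iff hω hrq] at hsL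
    have hc : ((ω ^ e) ^ (k - 1)) ^ 2 = 1 := by
      rw [← pow_mul, ← zpow_natCast, ← zpow_mul, zpow_generator_eq_one_iff hω hq]
      obtain ⟨f, rfl⟩ := he
      exact ⟨f, by push_cast; ring⟩
    have hd1 : s.left ^ (k - 1) = 1 := by
      rw [hd, ← zpow_natCast, ← zpow_mul, zpow_generator_eq_one_iff hω hq]
      have hrm : (r : ℤ) ∣ m := by
        rw [← two_mul] at hsL
        refine IsCoprime.dvd_of_dvd_mul_left ?_ hsL
        exact_mod_cast Nat.isCoprime_iff_coprime.2 (Nat.coprime_two_right.2 hr)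
      obtain ⟨n, rfl⟩ := hrm
      exact ⟨n, by push_cast; ring⟩
    rw [div_pow, mul_pow, hd1, one_mul, ← map_pow, unitsAutHom_eq_self_of_sq _ hc, div_self']
  rcases h with ⟨rfl, hq, rfl, rfl, rfl, rfl⟩ | ⟨rfl, hq, rfl, rfl, rfl, rfl⟩ |
    ⟨rfl, hq, rfl, rfl, rfl, hA⟩ | ⟨rfl, hq, rfl, rfl, rfl, hA⟩ | ⟨rfl, hq, rfl, rfl, hH, i, -, rfl⟩
  · exact ⟨1, 1, by simp, fun s _ => htop 2 (by norm_num) hq s⟩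
  · exact ⟨2, 1, by simp, fun s _ => htop 4 (by norm_num) hq s⟩
  · obtain ⟨e, he, rfl⟩ : ∃ e : ℤ, (5 : ℤ) ∣ e ∧ A = mulSubfield ((ω ^ e : Fˣ) : F) 9 := by
      rcases hA with rfl | rfl
      · exact ⟨0, by norm_num, by rw [hone0]⟩
      · exact ⟨(5 : ℕ), by norm_num, by rw [hone]⟩
    exact ⟨2, ω ^ e, by norm_num, fun s hs =>
      hsq 9 e (by norm_num) (by decide) hq he s (squares_sup_le 3 hs)⟩
  · obtain ⟨e, he, rfl⟩ : ∃ e : ℤ, (3 : ℤ) ∣ e ∧ A = mulSubfield ((ω ^ e : Fˣ) : F) 5 := by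
      rcases hA with rfl | rfl
      · exact ⟨0, by norm_num, by rw [hone0]⟩
      · exact ⟨(3 : ℕ), by norm_num, by rw [hone]⟩
    exact ⟨1, ω ^ e, by norm_num, fun s hs =>
      hsq 5 e (by norm_num) (by decide) hq he s (squares_sup_le 5 hs)⟩
  · refine ⟨1, ω ^ i, by rw [Units.val_pow_eq_pow_val]; norm_num, ?_⟩
    have hω8 : ω ^ 8 = 1 := by
      exact_mod_cast (zpow_generator_eq_one_iff hω hq 8).2 dvd_rfl
    have key : ∀ j : ℕ, ¬ 2 ∣ j → ∀ s ∈ Subgroup.zpowers (SemidirectProduct.inl ((ω ^ 2) ^ 2)) ⊔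
        Subgroup.zpowers (⟨ω ^ j, frobAut F 3⟩ : DetAut F),
        s.left ∈ Subgroup.zpowers (ω ^ 2) →
        ∀ x ∈ mulSubfield ((ω : F) ^ i) 3, s.right x / s.left ∈ mulSubfield ((ω : F) ^ i) 3 := by
      intro j hj s hs hsL
      have hw : (ω ^ j) ^ 8 = 1 := by rw [pow_right_comm, hω8, one_pow]
      rw [← Units.val_pow_eq_pow_val]
      refine div_mem_mulSubfield (by norm_num) ?_
      rcases twisted_sup_le hq hw hω8 hs with ⟨h1, h2⟩ | ⟨-, h2⟩
      · rw [h1, map_one, MulAut.one_apply, div_mul_cancel_right, inv_pow, h2, inv_one]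
      -- Elements involving Frobenius have determinant `ω` to an odd power, so they never have
      -- trivial level.
      · exfalso
        obtain ⟨m, hm⟩ := Subgroup.mem_zpowers_iff.1 (hω s.left)
        rw [← hm, zpow_generator_mem_iff hω hrq] at hsL
        rw [← hm, ← pow_mul, ← zpow_natCast, ← zpow_natCast, ← zpow_mul, ← mul_inv_eq_one,
          ← zpow_sub, zpow_generator_eq_one_iff hω hq] at h2
        push_cast at *
        omega
    rcases hH with rfl | rfl
    · have := key 1 (by norm_num)
      rwa [pow_one] at this
    · exact key 3 (by norm_num)

end Converse

/-! ### Translation to points -/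

section Translation

set_option linter.unusedSectionVars false

variable {F : Type*} [Field F] [Finite F] {ω : Fˣ} {r : ℕ}

theorem isNontrivialBlockIn_iff (hω : ∀ x : Fˣ, x ∈ Subgroup.zpowers ω) (hr : 0 < r)
    {G : Subgroup (GammaL F)} (hG : YSL2 ω r ≤ G) {B : Set (Points ω r)} (hB : betaPt ω r ∈ B) :
    IsNontrivialBlockIn (MulAction.stabilizer G (alphaPt ω r)) (sigmaOf ω r e1)ᶜ B ↔
      B ⊆ (sigmaOf ω r e1)ᶜ ∧ IsBaseBlock ω r (G.map detAut) (affSet B) ∧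
      (∃ z ∈ affSet B, ¬(z.1 = 0 ∧ z.2 ∈ Subgroup.zpowers (ω ^ r))) ∧
      affSet B ≠ Set.univ := by
  rw [betaPt_eq] at hB
  have hβ : ∀ x u, affPt ω r x u = affPt ω r 0 1 ↔ x = 0 ∧ u ∈ Subgroup.zpowers (ω ^ r) := by
    intro x u
    rw [eq_comm, affPt_eq_iff, div_one, eq_comm]
  have huniv : B ⊆ (sigmaOf ω r e1)ᶜ → (B = (sigmaOf ω r e1)ᶜ ↔ affSet B = Set.univ) := by
    intro hsub
    rw [eq_iff_affSet_eq hω hr hsub subset_rfl, affSet_sigmaOf_compl hω hr]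
  constructor
  · rintro ⟨hsub, hblock, hnt, hne⟩
    refine ⟨hsub, ⟨(isBlock_iff_isAffBlock hω hr hG hsub).1 hblock, hB,
      fun x u l => affSet_mul_mem B x u l⟩, ?_, fun h => hne ((huniv hsub).2 h)⟩
    obtain ⟨P, hP, hPβ⟩ := hnt.exists_ne (affPt ω r 0 1)
    obtain ⟨x, u, rfl⟩ := exists_affPt hω hr P (hsub hP)
    exact ⟨(x, u), hP, fun h => hPβ ((hβ x u).2 h)⟩
  · rintro ⟨hsub, hblock, ⟨⟨x, u⟩, hz, hz'⟩, hne⟩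
    refine ⟨hsub, (isBlock_iff_isAffBlock hω hr hG hsub).2 hblock.block,
      ⟨_, hz, _, hB, fun h => hz' ((hβ x u).1 h)⟩, fun h => hne ((huniv hsub).1 h)⟩

theorem ncard_blockB1 (hω : ∀ x : Fˣ, x ∈ Subgroup.zpowers ω)
    (hrq : r ∣ Nat.card F - 1) : (blockB1 ω r).ncard = r := by
  have h : blockB1 ω r = (fun i : ℕ => affPt ω r 0 (ω ^ i)) '' Set.Iio r := by
    ext P
    constructor
    · rintro ⟨v, ⟨i, hi, rfl⟩, hP⟩
      exact ⟨i, hi, Subtype.ext ((point_smul_e2 ω r _).trans hP.symm)⟩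
    · rintro ⟨i, hi, rfl⟩
      exact ⟨_, ⟨i, hi, rfl⟩, point_smul_e2 ω r _⟩
  rw [h, Set.InjOn.ncard_image]
  · rw [← Finset.coe_Iio, Set.ncard_coe_finset, Nat.card_Iio]
  · intro i hi j hj hij
    have h1 := ((affPt_eq_iff ω r _ _ _ _).1 hij).2
    rw [← zpow_natCast ω j, ← zpow_natCast ω i, zpow_div_zpow_mem_iff hω hrq] at h1
    simp only [Set.mem_Iio] at hi hj
    have := Int.eq_zero_of_abs_lt_dvd h1 (by rw [abs_lt]; omega)
    omega

theorem mulSubfield_one_two : mulSubfield (1 : F) 2 = {0, 1} := by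
  ext x
  constructor
  · rintro ⟨y, hy, rfl⟩
    rw [one_mul]
    have : y * (y - 1) = 0 := by linear_combination hy
    rcases mul_eq_zero.1 this with h | h
    · exact Or.inl h
    · exact Or.inr (sub_eq_zero.1 h)
  · rintro (rfl | rfl)
    · exact ⟨0, by norm_num, by ring⟩
    · exact ⟨1, by norm_num, by ring⟩

theorem pts_pair_eq_lineBlock :
    pts ω r {e2, e1 + e2} = lineBlock ω r (mulSubfield 1 2) := by
  rw [mulSubfield_one_two, lineBlock]
  congr 1
  ext v
  constructor
  · rintro (rfl | rfl)
    · exact ⟨0, Or.inl rfl, by rw [zero_smul, zero_add]⟩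
    · exact ⟨1, Or.inr rfl, by rw [one_smul]⟩
  · rintro ⟨x, rfl | rfl, rfl⟩
    · left; rw [zero_smul, zero_add]
    · right; rw [one_smul]; rfl

theorem pts_one_add_eq_range (ω : Fˣ) (r : ℕ) :
    pts ω r {v | ∃ x : F, x ≠ 0 ∧ v = (1 + x) • e1 + x • e2} =
      Set.range fun u : Fˣ => affPt ω r (1 + (u : F)⁻¹) u := by
  have key : ∀ u : Fˣ, (affPt ω r (1 + (u : F)⁻¹) u).1 =
      omr ω r ((1 + (u : F)) • e1 + (u : F) • e2) := by
    intro u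
    change omr ω r _ = _
    congr 1
    ext i; fin_cases i
    · simp [e1, e2, mul_add, add_comm]
    · simp [e1, e2]
  ext P
  constructor
  · rintro ⟨v, ⟨x, hx, rfl⟩, hP⟩
    exact ⟨Units.mk0 x hx, Subtype.ext ((key _).trans hP.symm)⟩
  · rintro ⟨u, rfl⟩
    exact ⟨_, ⟨u, u.ne_zero, rfl⟩, key u⟩

/-- With `ω ^ r = 1` points are single vectors, so `u` is determined by the point and the graph
equation is meaningful. -/
theorem affSet_pts_one_add (hωr : ω ^ r = 1) :
    affSet (pts ω r {v | ∃ x : F, x ≠ 0 ∧ v = (1 + x) • e1 + x • e2}) =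
      {z | z.1 = 1 + (z.2 : F)⁻¹} := by
  ext ⟨x, u⟩
  rw [pts_one_add_eq_range]
  constructor
  · rintro ⟨w, hw⟩
    obtain ⟨h1, h2⟩ := (affPt_eq_iff ω r _ _ _ _).1 hw
    rw [hωr, Subgroup.zpowers_one_eq_bot, Subgroup.mem_bot, div_eq_one] at h2
    exact h1.symm.trans (by rw [h2])
  · intro h
    have h : x = 1 + (u : F)⁻¹ := h
    exact ⟨u, by rw [h]⟩

theorem pts_one_add_subset (hω : ∀ x : Fˣ, x ∈ Subgroup.zpowers ω) (hr : 0 < r) :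
    pts ω r {v | ∃ x : F, x ≠ 0 ∧ v = (1 + x) • e1 + x • e2} ⊆ (sigmaOf ω r e1)ᶜ := by
  rw [pts_one_add_eq_range]
  rintro _ ⟨u, rfl⟩
  exact affPt_notMem_sigmaOf hω hr _ u

theorem ncard_pts_one_add (hωr : ω ^ r = 1) :
    (pts ω r {v | ∃ x : F, x ≠ 0 ∧ v = (1 + x) • e1 + x • e2}).ncard = Nat.card F - 1 := by
  rw [pts_one_add_eq_range, ← Set.image_univ, Set.ncard_image_of_injective, Set.ncard_univ,
    Nat.card_units]
  intro u w h
  have h2 := ((affPt_eq_iff ω r _ _ _ _).1 h).2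
  rw [hωr, Subgroup.zpowers_one_eq_bot, Subgroup.mem_bot, div_eq_one] at h2
  exact h2.symm

theorem prime_eq_of_card (p : ℕ) [hp : Fact p.Prime] [CharP F p] {m n : ℕ} (hm : m.Prime)
    (h : Nat.card F = m ^ n) : p = m := by
  have _ : Fintype F := Fintype.ofFinite F
  obtain ⟨a, -, ha⟩ := FiniteField.card F p
  rw [← Nat.card_eq_fintype_card, h] at ha
  have h1 : p ∣ m ^ n := ha ▸ dvd_pow_self p a.pos.ne'
  exact (Nat.prime_dvd_prime_iff_eq hp.out hm).1 (hp.out.dvd_of_dvd_pow h1)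

theorem eq_top_iff_map_detAut {G : Subgroup (GammaL F)} (hG : YSL2 ω r ≤ G) :
    G = ⊤ ↔ G.map detAut = ⊤ := by
  rw [eq_iff_map_detAut_eq (ker_detAut_le_of_YSL2_le hG) le_top, ← MonoidHom.range_eq_map,
    MonoidHom.range_eq_top.2 detAut_surjective]

theorem eq_sup_iff_map_detAut {G : Subgroup (GammaL F)} (hG : YSL2 ω r ≤ G) (n : ℕ)
    (g : GammaL F) : G = YSL2 ω n ⊔ Subgroup.zpowers g ↔ G.map detAut =
      Subgroup.zpowers (SemidirectProduct.inl ((ω ^ n) ^ 2)) ⊔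
        Subgroup.zpowers (detAut g) := by
  rw [eq_iff_map_detAut_eq (ker_detAut_le_of_YSL2_le hG)
    ((ker_detAut_le_of_YSL2_le le_rfl).trans le_sup_left), Subgroup.map_sup, map_detAut_YSL2,
    MonoidHom.map_zpowers]

theorem detAut_diagMap_mul_phiMap (p : ℕ) [Fact p.Prime] [CharP F p] (w : Fˣ) :
    detAut (diagMap 1 w * phiMap p) = ⟨w, frobAut F p⟩ := by
  rw [map_mul, detAut_diagMap, detAut_phiMap, one_mul, inl_mul_eq]
  simp

/-- Every block in the table is a line block over a coset of a subfield, except the one of size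
three for `q = 4`, which crosses the levels. -/
theorem isAdditionalBlock_iff (p : ℕ) [Fact p.Prime] [CharP F p] {G : Subgroup (GammaL F)}
    (hG : YSL2 ω r ≤ G) (B : Set (Points ω r)) (k : ℕ) :
    IsAdditionalBlock p ω r G B k ↔
      (Nat.card F = 4 ∧ r = 3 ∧ G.map detAut = ⊤ ∧
        B = pts ω r {v | ∃ x : F, x ≠ 0 ∧ v = (1 + x) • e1 + x • e2} ∧ k = 3) ∨
      ∃ A, IsAdditionalAffBlock p ω r (G.map detAut) A k ∧ B = lineBlock ω r A := by
  rw [IsAdditionalBlock, eq_top_iff_map_detAut hG, eq_sup_iff_map_detAut hG,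
    eq_sup_iff_map_detAut hG, eq_sup_iff_map_detAut hG, detAut_diagMap_mul_phiMap,
    detAut_diagMap_mul_phiMap, detAut_phiMap, pts_pair_eq_lineBlock]
  constructor
  · rintro (⟨hq, hr, hH, ⟨hB, hk⟩ | ⟨hB, hk⟩⟩ | ⟨hq, hr, hH, hB, hk⟩ | ⟨hq, hr, hH, hB, hk⟩ |
      ⟨hq, hr, hH, hB, hk⟩ | ⟨hq, hr, hH, ⟨i, hi, hB⟩, hk⟩)
    · have hp := prime_eq_of_card (F := F) p Nat.prime_two (n := 2) hq
      exact Or.inr ⟨_, Or.inl ⟨hp, hq, hr, hk, hH, rfl⟩, hB⟩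
    · exact Or.inl ⟨hq, hr, hH, hB, hk⟩
    · have hp := prime_eq_of_card (F := F) p Nat.prime_two hq
      exact Or.inr ⟨_, Or.inr (Or.inl ⟨hp, hq, hr, hk, hH, rfl⟩), hB⟩
    · have hp := prime_eq_of_card (F := F) p Nat.prime_three hq
      rcases hB with hB | hB
      · exact Or.inr ⟨_, Or.inr (Or.inr (Or.inl ⟨hp, hq, hr, hk, hH, Or.inl rfl⟩)), hB⟩
      · exact Or.inr ⟨_, Or.inr (Or.inr (Or.inl ⟨hp, hq, hr, hk, hH, Or.inr rfl⟩)), hB⟩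
    · have hp := prime_eq_of_card (F := F) p Nat.prime_five hq
      rcases hB with hB | hB
      · exact Or.inr ⟨_, Or.inr (Or.inr (Or.inr (Or.inl ⟨hp, hq, hr, hk, hH, Or.inl rfl⟩))), hB⟩
      · exact Or.inr ⟨_, Or.inr (Or.inr (Or.inr (Or.inl ⟨hp, hq, hr, hk, hH, Or.inr rfl⟩))), hB⟩
    · have hp := prime_eq_of_card (F := F) p Nat.prime_three hq
      exact Or.inr ⟨_, Or.inr (Or.inr (Or.inr (Or.inr ⟨hp, hq, hr, hk, hH, i, hi, rfl⟩))), hB⟩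
  · rintro (⟨hq, hr, hH, hB, hk⟩ | ⟨A, ⟨-, hq, hr, hk, hH, rfl⟩ | ⟨-, hq, hr, hk, hH, rfl⟩ |
      ⟨-, hq, hr, hk, hH, hA⟩ | ⟨-, hq, hr, hk, hH, hA⟩ | ⟨-, hq, hr, hk, hH, i, hi, rfl⟩, rfl⟩)
    · exact Or.inl ⟨hq, hr, hH, Or.inr ⟨hB, hk⟩⟩
    · exact Or.inl ⟨hq, hr, hH, Or.inl ⟨rfl, hk⟩⟩
    · exact Or.inr (Or.inl ⟨hq, hr, hH, rfl, hk⟩)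
    · exact Or.inr (Or.inr (Or.inl ⟨hq, hr, hH, hA.imp (congrArg _) (congrArg _), hk⟩))
    · exact Or.inr (Or.inr (Or.inr (Or.inl ⟨hq, hr, hH, hA.imp (congrArg _) (congrArg _), hk⟩)))
    · exact Or.inr (Or.inr (Or.inr (Or.inr ⟨hq, hr, hH, ⟨i, hi, rfl⟩, hk⟩)))

end Translation

/-! ### The theorem -/

theorem theorem4p10 {F : Type*} [Field F] [Finite F] (p : ℕ) [Fact p.Prime] [CharP F p]
    (ω : Fˣ) (hω : ∀ x : Fˣ, x ∈ Subgroup.zpowers ω)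
    (hq : Nat.card F ≠ 3) (r : ℕ) (hr : 1 < r) (hrq : r ∣ Nat.card F - 1)
    (G : Subgroup (GammaL F)) (hG : YSL2 ω r ≤ G)
    (hyp : IsRankThreeImprimitiveITorSP (permGroupOn ω r G))
    (B : Set (Points ω r)) (hB : betaPt ω r ∈ B) :
    (IsNontrivialBlockIn (MulAction.stabilizer G (alphaPt ω r)) (sigmaOf ω r e1)ᶜ B →
      (B = blockB1 ω r ∧ B.ncard = r) ∨
      (B = blockB2 ω r ∧ B.ncard = Nat.card F) ∨
      (∃ k : ℕ, IsAdditionalBlock p ω r G B k ∧ B.ncard = k)) ∧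
    ((B = blockB1 ω r ∨ B = blockB2 ω r ∨ ∃ k : ℕ, IsAdditionalBlock p ω r G B k) →
      IsNontrivialBlockIn (MulAction.stabilizer G (alphaPt ω r)) (sigmaOf ω r e1)ᶜ B) := by
  have hr0 : 0 < r := by omega
  have hH := isRankThreeDetAut_of_isRankThree hω hr hrq hG hyp.1
  have hrp := hH.prime hω hr hrq
  have hωr : Nat.card F = 4 → r = 3 → ω ^ r = 1 := by
    rintro h4 rfl
    exact_mod_cast (zpow_generator_eq_one_iff hω (n := 3) h4 3).2 dvd_rfl
  have hωL : ω ∉ Subgroup.zpowers (ω ^ r) := by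
    have := pow_generator_mem_iff hω hrq 1
    rw [pow_one] at this
    rw [this, Nat.dvd_one]
    omega
  constructor
  · intro h
    obtain ⟨hsub, hP, hnt, hne⟩ := (isNontrivialBlockIn_iff hω hr0 hG hB).1 h
    rcases hP.classification hH hω hrp hrq p hq hnt hne with h1 | h2 | ⟨hq4, hr3, hH', h3⟩ |
      ⟨k, A, hA, hcard, h4⟩
    · have : B = blockB1 ω r := by
        rw [eq_iff_affSet_eq hω hr0 hsub (blockB1_subset hω hr0), affSet_blockB1 hω hr0, h1]
      exact Or.inl ⟨this, by rw [this, ncard_blockB1 hω hrq]⟩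
    · have : B = blockB2 ω r := by
        rw [blockB2, eq_iff_affSet_eq hω hr0 hsub (lineBlock_subset hω hr0 _), affSet_lineBlock, h2]
      exact Or.inr (Or.inl ⟨this, by rw [this, blockB2, ncard_lineBlock, Set.ncard_univ]⟩)
    · have : B = pts ω r {v | ∃ x : F, x ≠ 0 ∧ v = (1 + x) • e1 + x • e2} := by
        rw [eq_iff_affSet_eq hω hr0 hsub (pts_one_add_subset hω hr0),
          affSet_pts_one_add (hωr hq4 hr3), h3]
      exact Or.inr (Or.inr ⟨3, (isAdditionalBlock_iff p hG B 3).2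
        (Or.inl ⟨hq4, hr3, hH', this, rfl⟩),
        by rw [this, ncard_pts_one_add (hωr hq4 hr3), hq4]⟩)
    · have : B = lineBlock ω r A := by
        rw [eq_iff_affSet_eq hω hr0 hsub (lineBlock_subset hω hr0 _), affSet_lineBlock, h4]
      exact Or.inr (Or.inr ⟨k, (isAdditionalBlock_iff p hG B k).2 (Or.inr ⟨A, hA, this⟩),
        by rw [this, ncard_lineBlock, hcard]⟩)
  · have hline : ∀ (A : Set F), (∀ x ∈ A, ∀ y ∈ A, x + y ∈ A) → (∀ x ∈ A, ∀ y ∈ A, x - y ∈ A) →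
        (∀ s ∈ G.map detAut, s.left ∈ Subgroup.zpowers (ω ^ r) →
          ∀ x ∈ A, s.right x / s.left ∈ A) → (∃ x ∈ A, x ≠ 0) → B = lineBlock ω r A →
        IsNontrivialBlockIn (MulAction.stabilizer G (alphaPt ω r)) (sigmaOf ω r e1)ᶜ B := by
      rintro A hadd hsub hinv ⟨x, hx, hx0⟩ rfl
      rw [isNontrivialBlockIn_iff hω hr0 hG hB]
      rw [betaPt_eq] at hB
      refine ⟨lineBlock_subset hω hr0 A, ⟨?_, hB, fun x u l => affSet_mul_mem _ x u l⟩, ?_, ?_⟩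
      · rw [affSet_lineBlock]
        exact isAffBlock_lineSet A hadd hsub hinv
      · rw [affSet_lineBlock]
        exact ⟨(x, 1), ⟨hx, one_mem _⟩, fun h => hx0 h.1⟩
      · rw [affSet_lineBlock]
        intro h
        exact hωL (h.symm ▸ Set.mem_univ ((0 : F), ω) :
          ((0 : F), ω) ∈ {z : F × Fˣ | z.1 ∈ A ∧ z.2 ∈ Subgroup.zpowers (ω ^ r)}).2
    rintro (rfl | hB2 | ⟨k, hk⟩)
    · rw [isNontrivialBlockIn_iff hω hr0 hG hB]
      rw [betaPt_eq] at hB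
      refine ⟨blockB1_subset hω hr0, ⟨?_, hB, fun x u l => affSet_mul_mem _ x u l⟩, ?_, ?_⟩
      · rw [affSet_blockB1 hω hr0]
        exact isAffBlock_axis _
      · rw [affSet_blockB1 hω hr0]
        exact ⟨(0, ω), rfl, fun h => hωL h.2⟩
      · rw [affSet_blockB1 hω hr0]
        intro h
        exact one_ne_zero (h.symm ▸ Set.mem_univ ((1 : F), (1 : Fˣ)) :
          ((1 : F), (1 : Fˣ)) ∈ {z : F × Fˣ | z.1 = 0})
    · exact hline Set.univ (fun _ _ _ _ => trivial) (fun _ _ _ _ => trivial)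
        (fun _ _ _ _ _ => trivial) ⟨1, trivial, one_ne_zero⟩ hB2
    · rcases (isAdditionalBlock_iff p hG B k).1 hk with ⟨hq4, hr3, -, rfl, -⟩ | ⟨A, hA, hBA⟩
      · have h1 := hωr hq4 hr3
        rw [isNontrivialBlockIn_iff hω hr0 hG hB]
        rw [betaPt_eq] at hB
        refine ⟨pts_one_add_subset hω hr0, ⟨?_, hB, fun x u l => affSet_mul_mem _ x u l⟩, ?_, ?_⟩
        · rw [affSet_pts_one_add h1]
          exact isAffBlock_one_add_inv _
        · rw [affSet_pts_one_add h1]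
          exact ⟨(1 + (ω : F)⁻¹, ω), rfl, fun h => hωL h.2⟩
        · rw [affSet_pts_one_add h1]
          intro h
          have h2 : ((1 : F), (1 : Fˣ)) ∈ {z : F × Fˣ | z.1 = 1 + (z.2 : F)⁻¹} :=
            h.symm ▸ Set.mem_univ _
          have h3 : (1 : F) = 1 + ((1 : Fˣ) : F)⁻¹ := h2
          simp at h3
      · obtain ⟨b, c, rfl, hinv⟩ := hA.invariant hω hrq
        exact hline _ (add_mem_mulSubfield p (c : F) b).1 (add_mem_mulSubfield p (c : F) b).2 hinv
          ⟨(c : F), ⟨1, one_pow _, (mul_one _).symm⟩, c.ne_zero⟩ hBA
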